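/- **Notation.** $B(x,r)$ is the open ball in $\mathbb{R}^n$ and $\mathbb{B}=B(0,1)$. $\mathcal{H}^d$ is the $d$-dimensional Hausdorff measure, normalized so that the unit ball of $\mathbb{R}^d$ has $\mathcal{H}^d$-measure $1$. $\mu$ is a locally finite positive Borel measure on $\mathbb{R}^n$ with support $\Sigma$; it is doubling with constant $C_\delta$ if $\mu(B(x,2r))\le C_\delta\,\mu(B(x,r))$ for all $x\in\Sigma$, $r>0$. For measures $\mu,\nu$ on $\mathbb{R}^n$ whose restrictions to $\mathbb{B}$ are probability measures, put $\mathbb{W}_1(\mu,\nu)=\sup_\psi\left|\int\psi\,d\mu-\int\psi\,d\nu\right|$, the supremum being over all $1$-Lipschitz $\psi:\mathbb{R}^n\to\mathbb{R}$ that vanish outside $\mathbb{B}$. For $x\in\Sigma$, $r>0$ let $\mu_{x,r}(E)=\mu(x+rE)/\mu(B(x,r))$ for Borel sets $E$, and $$\alpha_d(x,r)=\inf_V\ \mathbb{W}_1(\mu_{x,r},\nu_V),\qquad \nu_V=\mathcal{H}^d(V\cap\mathbb{B})^{-1}\,\mathcal{H}^d|_V,$$ the infimum being over all $d$-dimensional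 affine planes $V\subset\mathbb{R}^n$ that meet $B(0,1/2)$. A $\gamma$-Lipschitz graph of dimension $d$ is a set $\{v+f(v): v\in V\}$, where $V$ is a $d$-dimensional vector subspace of $\mathbb{R}^n$ and $f:V\to V^\perp$ is $\gamma$-Lipschitz. **Theorem 1.7.** For every integer $d\ge 1$, every $C_\delta\ge 1$ and every $\gamma\in(0,1)$ there is a constant $C_1=C_1(d,C_\delta,\gamma)>0$ such that the following holds for every $n\ge d$. Let $\mu$ be a locally finite positive Borel measure on $\mathbb{R}^n$ that is doubling with constant $C_\delta$, let $\Sigma$ be its support, and let $B=B(x,r)$ with $x\in\Sigma$, $r>0$, be a ball such that $$\int_{B(x,2r)}\int_0^{2r}\alpha_d(y,t)\,\frac{dt\,d\mu(y)}{t}\ \le\ C_1\,\mu(B).$$ Then there is a Borel set $A\subset B$ such that $\mu(B\setminus A)\le\gamma\,\mu(B)$, $A$ is contained in a $\gamma$-Lipschitz graph of dimension $d$, and $$(1-\gamma)\,\frac{\mathcal{H}^d(Z)}{r^d}\ \le\ \frac{\mu(Z)}{\mu(B)}\ \le\ (1+\gamma)\,\frac{\mathcal{H}^d(Z)}{r^d}\qquad\text{for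 every Borel set } Z\subset A.$$ -/

import Mathlib

open MeasureTheory Metric Set
open scoped ENNReal

noncomputable section

/-- The `d`-dimensional Hausdorff measure on `ℝⁿ`, normalized so that the unit ball of `ℝᵈ`
has measure one. -/
def hausdorffN (d n : ℕ) : Measure (EuclideanSpace ℝ (Fin n)) :=
  (Measure.hausdorffMeasure (d : ℝ) (ball (0 : EuclideanSpace ℝ (Fin d)) 1))⁻¹ •
    Measure.hausdorffMeasure (d : ℝ)

/-- `μ` is doubling with constant `C`: `μ(B(x,2r)) ≤ C μ(B(x,r))` for all `x` in the support
of `μ` and all `r > 0`. -/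
def IsDoublingWith {n : ℕ} (C : ℝ) (μ : Measure (EuclideanSpace ℝ (Fin n))) : Prop :=
  ∀ x ∈ μ.support, ∀ r : ℝ, 0 < r → μ (ball x (2 * r)) ≤ ENNReal.ofReal C * μ (ball x r)

/-- `W₁(μ,ν) = sup |∫ ψ dμ - ∫ ψ dν|` over the `1`-Lipschitz functions `ψ : ℝⁿ → ℝ` that vanish
outside the open unit ball. -/
def wassersteinBall {n : ℕ} (μ ν : Measure (EuclideanSpace ℝ (Fin n))) : ℝ≥0∞ :=
  ⨆ (ψ : EuclideanSpace ℝ (Fin n) → ℝ) (_ : LipschitzWith 1 ψ)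
    (_ : Function.support ψ ⊆ ball 0 1),
    ENNReal.ofReal |∫ z, ψ z ∂μ - ∫ z, ψ z ∂ν|

/-- The rescaled measure `μ_{x,r}(A) = μ(x + rA) / μ(B(x,r))`, as a push-forward under
`y ↦ (y - x) / r`. -/
def rescaledMeasure {n : ℕ} (μ : Measure (EuclideanSpace ℝ (Fin n)))
    (x : EuclideanSpace ℝ (Fin n)) (r : ℝ) : Measure (EuclideanSpace ℝ (Fin n)) :=
  (μ (ball x r))⁻¹ • μ.map (fun y => r⁻¹ • (y - x))

/-- The `d`-dimensional affine planes of `ℝⁿ` that meet the open ball `B(0,1/2)`. -/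
def centralPlanes (d n : ℕ) : Set (AffineSubspace ℝ (EuclideanSpace ℝ (Fin n))) :=
  {V | Module.finrank ℝ V.direction = d ∧
    ((V : Set (EuclideanSpace ℝ (Fin n))) ∩ ball 0 (1 / 2)).Nonempty}

/-- The flat measure `ν_V = c_V ℋᵈ|_V`, with `c_V = ℋᵈ(V ∩ B(0,1))⁻¹`. -/
def flatMeasure {n : ℕ} (d : ℕ) (V : AffineSubspace ℝ (EuclideanSpace ℝ (Fin n))) :
    Measure (EuclideanSpace ℝ (Fin n)) :=
  (hausdorffN d n ((V : Set (EuclideanSpace ℝ (Fin n))) ∩ ball 0 1))⁻¹ •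
    (hausdorffN d n).restrict (V : Set (EuclideanSpace ℝ (Fin n)))

/-- `α_d(x,r) = inf { W₁(μ_{x,r}, ν_V) : V a d-plane that meets B(0,1/2) }`. -/
def alphaNumber {n : ℕ} (d : ℕ) (μ : Measure (EuclideanSpace ℝ (Fin n)))
    (x : EuclideanSpace ℝ (Fin n)) (r : ℝ) : ℝ≥0∞ :=
  ⨅ V ∈ centralPlanes d n, wassersteinBall (rescaledMeasure μ x r) (flatMeasure d V)

/-- The Carleson condition on `B(x,r)`:
`∫_{B(x,2r)} ∫_0^{2r} α_d(y,t) dt/t dμ(y) ≤ C₁ μ(B(x,r))`. -/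
def CarlesonCondition {n : ℕ} (d : ℕ) (C₁ : ℝ) (μ : Measure (EuclideanSpace ℝ (Fin n)))
    (x : EuclideanSpace ℝ (Fin n)) (r : ℝ) : Prop :=
  ∫⁻ y in ball x (2 * r), (∫⁻ t in Ioo (0 : ℝ) (2 * r), alphaNumber d μ y t / ENNReal.ofReal t) ∂μ
    ≤ ENNReal.ofReal C₁ * μ (ball x r)

/-- `Γ` is a `γ`-Lipschitz graph of dimension `d`: `Γ = {v + f(v) : v ∈ V}` with `V` a
`d`-dimensional vector subspace and `f : V → Vᗮ` a `γ`-Lipschitz map. -/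
def IsLipschitzGraph {n : ℕ} (d : ℕ) (γ : ℝ) (Γ : Set (EuclideanSpace ℝ (Fin n))) : Prop :=
  ∃ (V : Submodule ℝ (EuclideanSpace ℝ (Fin n))) (f : V → Vᗮ),
    Module.finrank ℝ V = d ∧ (∀ v w : V, ‖f v - f w‖ ≤ γ * ‖v - w‖) ∧
    Γ = range (fun v : V => (v : EuclideanSpace ℝ (Fin n)) + (f v : EuclideanSpace ℝ (Fin n)))

end

/-! Smallness of the α-numbers integrated against dt/t makes `μ` look flat at most points of B, with
errors that are summable over the dyadic scales. Approximating directions and densities then drift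
very little in total, and this yields both the graph and the density bounds.

A bound on `wassersteinBall` becomes a `FlatApprox`: against Lipschitz test functions in a ball, `μ`
is c·ℋᵈ on a plane up to a small error. Two such approximations in one ball centred on the support
have nearly equal directions and coefficients (`exists_compare_const`); the test functions are
tents, and the distance to a plane cut off by a tent. By Chebyshev the Carleson bound makes the
errors at the scales r/2ᵏ sum to at most η outside a small part of B (`exists_carleson_const`).
Summing the comparisons over the scales keeps every direction and density at a good point close to
those of one plane fixed for B (`exists_chain_const`). Support points lie near the approximating
plane at each scale, so y - z makes a small angle with the fixed plane as soon as y is good, and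
μ(B(y,r/2ᵏ)) is close to c₀(r/2ᵏ)ᵈ (`exists_good_point_const`).

The good set is therefore a piece of a Lipschitz graph. Kirszbraun's theorem extends the graph map
with the same constant, so no dependence on n enters. The density bounds on balls become bounds on
Borel sets after projection to ℝᵈ and a Besicovitch differentiation argument; for the lower bound
the good set is first reduced to its density points. -/

open scoped NNReal

/-! ### Kirszbraun's extension theorem, by minimax and compactness. -/

section Kirszbraun

variable {X Y : Type*} [NormedAddCommGroup X] [InnerProductSpace ℝ X]
  [NormedAddCommGroup Y] [InnerProductSpace ℝ Y]

/-- The weighted variance of a finite family of points about `a`, expressed by mutual distances. -/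
theorem sum_sum_mul_norm_sub_sq {ι : Type*} (s : Finset ι) (w : ι → ℝ) (hw : ∑ i ∈ s, w i = 1)
    (y : ι → Y) (a : Y) :
    ∑ i ∈ s, ∑ j ∈ s, w i * w j * ‖y i - y j‖ ^ 2
      = 2 * ∑ i ∈ s, w i * ‖y i - a‖ ^ 2 - 2 * ‖∑ i ∈ s, w i • (y i - a)‖ ^ 2 := by
  have h1 : ∀ i j, w i * w j * ‖y i - y j‖ ^ 2 = w j * (w i * ‖y i - a‖ ^ 2)
      + w i * (w j * ‖y j - a‖ ^ 2) - 2 * inner ℝ (w i • (y i - a)) (w j • (y j - a)) := by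
    intro i j
    have : y i - y j = (y i - a) - (y j - a) := by abel
    rw [this, norm_sub_sq_real, real_inner_smul_left, real_inner_smul_right]
    ring
  simp only [h1, Finset.sum_sub_distrib, Finset.sum_add_distrib, ← Finset.mul_sum, ← Finset.sum_mul,
    hw, one_mul]
  rw [← real_inner_self_eq_norm_sq, sum_inner]
  simp only [inner_sum]
  ring

/-- Finitely many closed balls in a Hilbert space whose centers are contracted still meet. -/
theorem exists_forall_norm_sub_le_of_contracting {ι : Type*} (s : Finset ι)
    (x : ι → X) (y : ι → Y) (h : ∀ i ∈ s, ∀ j ∈ s, ‖y i - y j‖ ≤ ‖x i - x j‖) (a : X) :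
    ∃ b : Y, ∀ i ∈ s, ‖b - y i‖ ≤ ‖a - x i‖ := by
  classical
  rcases s.eq_empty_or_nonempty with rfl | hs
  · exact ⟨0, by simp⟩
  let K : Set Y := convexHull ℝ (y '' s)
  have hK : Convex ℝ K := convex_convexHull ..
  let S : Set (s → ℝ) := stdSimplex ℝ s
  let f : Y → (s → ℝ) → ℝ := fun b w => ∑ i : s, w i * (‖b - y i‖ ^ 2 - ‖a - x i‖ ^ 2)
  have : Nonempty s := hs.to_subtype
  have hconv : ∀ w ∈ S, ConvexOn ℝ K fun b => f b w := by
    intro w hw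
    refine Finset.sum_induction (s := Finset.univ) (fun (i : s) b => w i * (‖b - y i‖ ^ 2 - ‖a - x i‖ ^ 2))
      (fun g : Y → ℝ => ConvexOn ℝ K g) (fun _ _ => ConvexOn.add) (convexOn_const 0 hK)
      (fun i _ => ?_) |>.congr (fun b _ => by simp [f, Finset.sum_apply])
    have hsq : ConvexOn ℝ K fun b => ‖b - y i‖ ^ 2 := by
      simpa only [dist_eq_norm, Pi.pow_def] using
        (convexOn_dist (y i) hK).pow (fun _ _ => dist_nonneg) 2
    exact ((hsq.add_const (-‖a - x i‖ ^ 2)).smul (hw.1 i)).congr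
      (fun b _ => by simp [sub_eq_add_neg])
  have hconc : ∀ b ∈ K, ConcaveOn ℝ S fun w => f b w := by
    intro b _
    refine ⟨convex_stdSimplex ℝ _, fun w _ w' _ α β _ _ _ => le_of_eq ?_⟩
    simp only [f, smul_eq_mul, Pi.add_apply, Pi.smul_apply, Finset.mul_sum,
      ← Finset.sum_add_distrib]
    exact Finset.sum_congr rfl fun i _ => by ring
  -- Minimax for `f`, convex in the point and affine in the weights: at a saddle point `(b, w)`, the
  -- value of `f b` at every vertex of the simplex is at most `f b' w` for any `b'` in the hull. The
  -- barycentre of the `y i` with weights `w` makes the latter nonpositive, by the variance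
  -- identity.
  obtain ⟨b, hb, w, hw, hsad⟩ := Sion.exists_isSaddlePointOn (X := K) (Y := S) (f := f)
    (hs.to_set.image y).convexHull hK
    ((s.finite_toSet.image y).isCompact_convexHull ℝ)
    (fun w _ => ContinuousOn.lowerSemicontinuousOn (by fun_prop))
    (fun w hw => (hconv w hw).quasiconvexOn)
    (convex_stdSimplex ℝ _) ⟨_, single_mem_stdSimplex ℝ (Classical.arbitrary s)⟩
    (isCompact_stdSimplex ℝ _)
    (fun b _ => ContinuousOn.upperSemicontinuousOn (by fun_prop))
    (fun b hb => (hconc b hb).quasiconcaveOn)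
  set b' : Y := ∑ i : s, w i • y i with hb'
  have hb'K : b' ∈ K := (convex_convexHull ℝ _).sum_mem (fun i _ => hw.1 i) hw.2
    fun i _ => subset_convexHull ℝ _ ⟨i, i.2, rfl⟩
  have hnonpos : f b' w ≤ 0 := by
    have e1 := sum_sum_mul_norm_sub_sq Finset.univ w hw.2 (fun i : s => y i) b'
    have e2 := sum_sum_mul_norm_sub_sq Finset.univ w hw.2 (fun i : s => x i) a
    have e3 : ∑ i : s, w i • (y i - b') = 0 := by
      simp only [smul_sub, Finset.sum_sub_distrib, ← Finset.sum_smul, hw.2, one_smul, ← hb', sub_self]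
    have e4 : ∑ i : s, ∑ j : s, w i * w j * ‖y i - y j‖ ^ 2
        ≤ ∑ i : s, ∑ j : s, w i * w j * ‖x i - x j‖ ^ 2 := by
      refine Finset.sum_le_sum fun i _ => Finset.sum_le_sum fun j _ => ?_
      have := mul_nonneg (hw.1 i) (hw.1 j)
      have := h i i.2 j j.2
      gcongr
    rw [e3, norm_zero] at e1
    have e5 : f b' w = ∑ i : s, w i * ‖y i - b'‖ ^ 2 - ∑ i : s, w i * ‖x i - a‖ ^ 2 := by
      simp only [f, mul_sub, Finset.sum_sub_distrib, norm_sub_rev]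
    nlinarith [sq_nonneg ‖∑ i : s, w i • (x i - a)‖]
  refine ⟨b, fun i hi => ?_⟩
  have h1 := (hsad b' hb'K _ (single_mem_stdSimplex ℝ (⟨i, hi⟩ : s))).trans hnonpos
  have h2 : f b (Pi.single (⟨i, hi⟩ : s) 1) = ‖b - y i‖ ^ 2 - ‖a - x i‖ ^ 2 := by
    simp only [f]
    rw [Finset.sum_eq_single (⟨i, hi⟩ : s)]
    · simp
    · intro j _ hj; simp [hj]
    · simp
  rw [h2] at h1
  exact le_of_sq_le_sq (by linarith) (norm_nonneg _)

/-- **Kirszbraun's theorem** for maps into a finite-dimensional Euclidean space. -/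
theorem exists_extension_norm_sub_le [FiniteDimensional ℝ Y] {s : Set X} {g : X → Y} {K : ℝ}
    (hK : 0 ≤ K) (hg : ∀ u ∈ s, ∀ v ∈ s, ‖g u - g v‖ ≤ K * ‖u - v‖) :
    ∃ f : X → Y, (∀ u v, ‖f u - f v‖ ≤ K * ‖u - v‖) ∧ EqOn f g s := by
  classical
  let P : Set (Set (X × Y)) := {G | ∀ p ∈ G, ∀ q ∈ G, ‖p.2 - q.2‖ ≤ K * ‖p.1 - q.1‖}
  have h0 : (fun u => (u, g u)) '' s ∈ P := by
    rintro _ ⟨u, hu, rfl⟩ _ ⟨v, hv, rfl⟩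
    exact hg u hu v hv
  obtain ⟨G, hG0, hG⟩ := zorn_subset_nonempty P (fun c hc hchain _ => by
    refine ⟨⋃₀ c, ?_, fun _ => subset_sUnion_of_mem⟩
    rintro p ⟨A, hA, hp⟩ q ⟨B, hB, hq⟩
    rcases hchain.total hA hB with hAB | hAB
    · exact hc hB p (hAB hp) q hq
    · exact hc hA p hp q (hAB hq)) _ h0
  have hGP : ∀ p ∈ G, ∀ q ∈ G, ‖p.2 - q.2‖ ≤ K * ‖p.1 - q.1‖ := hG.prop
  have htotal : ∀ a : X, ∃ b : Y, (a, b) ∈ G := by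
    intro a
    have : ∃ b : Y, ∀ p ∈ G, ‖b - p.2‖ ≤ K * ‖a - p.1‖ := by
      rcases G.eq_empty_or_nonempty with hE | ⟨p₀, hp₀⟩
      · exact ⟨0, by simp [hE]⟩
      -- One fixed ball, centred at `p₀.2`, supplies the compact set for the finite intersection
      -- property. Scaling the centres in `X` by `K` reduces to the contracting case.
      have hfin : ∀ t : Finset G, (closedBall p₀.2 (K * ‖a - p₀.1‖) ∩
          ⋂ p ∈ t, closedBall (p : X × Y).2 (K * ‖a - (p : X × Y).1‖)).Nonempty := by
        intro t
        obtain ⟨b, hb⟩ := exists_forall_norm_sub_le_of_contracting (insert ⟨p₀, hp₀⟩ t)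
          (fun p : G => K • (p : X × Y).1) (fun p : G => (p : X × Y).2)
          (fun p _ q _ => by
            rw [← smul_sub, norm_smul, Real.norm_of_nonneg hK]
            exact hGP p p.2 q q.2) (K • a)
        simp only [← smul_sub, norm_smul, Real.norm_of_nonneg hK] at hb
        refine ⟨b, by simpa [dist_eq_norm] using hb ⟨p₀, hp₀⟩ (Finset.mem_insert_self _ _), ?_⟩
        simp only [mem_iInter, mem_closedBall, dist_eq_norm]
        exact fun p hp => hb p (Finset.mem_insert_of_mem hp)
      have := FiniteDimensional.proper_real Y
      obtain ⟨b, -, hb⟩ := (isCompact_closedBall p₀.2 (K * ‖a - p₀.1‖)).inter_iInter_nonempty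
        (fun p : G => closedBall (p : X × Y).2 (K * ‖a - (p : X × Y).1‖))
        (fun _ => isClosed_closedBall) hfin
      refine ⟨b, fun p hp => ?_⟩
      simpa [dist_eq_norm] using mem_iInter.1 hb ⟨p, hp⟩
    obtain ⟨b, hb⟩ := this
    refine ⟨b, ?_⟩
    have hins : insert (a, b) G ∈ P := by
      rintro p (rfl | hp) q (rfl | hq)
      · simp
      · exact hb q hq
      · rw [norm_sub_rev, norm_sub_rev p.1]
        exact hb p hp
      · exact hGP p hp q hq
    exact hG.le_of_ge hins (subset_insert _ _) (mem_insert _ _)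
  choose f hf using htotal
  refine ⟨f, fun u v => hGP _ (hf u) _ (hf v), fun u hu => ?_⟩
  have := hGP _ (hf u) _ (hG0 ⟨u, hu, rfl⟩)
  simpa [sub_eq_zero] using this

end Kirszbraun

/-! ### Normalized Hausdorff measure on Euclidean spaces and on planes. -/

theorem hausdorffMeasure_unit_ball_pos (d : ℕ) :
    0 < Measure.hausdorffMeasure (d : ℝ) (ball (0 : EuclideanSpace ℝ (Fin d)) 1) :=
  measure_ball_pos _ _ one_pos

theorem hausdorffMeasure_unit_ball_lt_top (d : ℕ) :
    Measure.hausdorffMeasure (d : ℝ) (ball (0 : EuclideanSpace ℝ (Fin d)) 1) < ∞ :=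
  measure_ball_lt_top

instance isAddHaarMeasure_hausdorffN (d : ℕ) : (hausdorffN d d).IsAddHaarMeasure :=
  Measure.IsAddHaarMeasure.smul _
    (ENNReal.inv_ne_zero.2 (hausdorffMeasure_unit_ball_lt_top d).ne)
    (ENNReal.inv_ne_top.2 (hausdorffMeasure_unit_ball_pos d).ne')

theorem hausdorffN_unit_ball (d : ℕ) :
    hausdorffN d d (ball (0 : EuclideanSpace ℝ (Fin d)) 1) = 1 := by
  simp only [hausdorffN, Measure.smul_apply, smul_eq_mul]
  exact ENNReal.inv_mul_cancel (hausdorffMeasure_unit_ball_pos d).ne'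
    (hausdorffMeasure_unit_ball_lt_top d).ne

theorem hausdorffN_ball {d : ℕ} (p : EuclideanSpace ℝ (Fin d)) {r : ℝ} (hr : 0 < r) :
    hausdorffN d d (ball p r) = ENNReal.ofReal (r ^ d) := by
  rw [Measure.addHaar_ball_of_pos _ _ hr, hausdorffN_unit_ball]; simp

theorem hausdorffN_closedBall {d : ℕ} (p : EuclideanSpace ℝ (Fin d)) {r : ℝ} (hr : 0 ≤ r) :
    hausdorffN d d (closedBall p r) = ENNReal.ofReal (r ^ d) := by
  rw [Measure.addHaar_closedBall _ _ hr, hausdorffN_unit_ball]; simp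

theorem hausdorffN_real_ball {d : ℕ} (p : EuclideanSpace ℝ (Fin d)) {r : ℝ} (hr : 0 < r) :
    (hausdorffN d d).real (ball p r) = r ^ d := by
  rw [Measure.real, hausdorffN_ball p hr, ENNReal.toReal_ofReal (by positivity)]

/-- The normalized Hausdorff measure does not increase more than `Kᵈ` under `K`-Lipschitz maps. -/
theorem hausdorffN_image_le {d m n : ℕ} {K : ℝ≥0}
    {f : EuclideanSpace ℝ (Fin m) → EuclideanSpace ℝ (Fin n)} {s : Set (EuclideanSpace ℝ (Fin m))}
    (hf : LipschitzOnWith K f s) :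
    hausdorffN d n (f '' s) ≤ (K : ℝ≥0∞) ^ d * hausdorffN d m s := by
  simp only [hausdorffN, Measure.smul_apply, smul_eq_mul]
  rw [mul_left_comm]
  gcongr
  simpa using hf.hausdorffMeasure_image_le (d := (d : ℝ)) (by positivity)

/-- The normalized Hausdorff measure on a plane, through an isometric parametrization. -/
theorem map_hausdorffN_of_isometry {d n : ℕ}
    {f : EuclideanSpace ℝ (Fin d) → EuclideanSpace ℝ (Fin n)} (hf : Isometry f) :
    (hausdorffN d d).map f = (hausdorffN d n).restrict (range f) := by
  simp only [hausdorffN]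
  rw [Measure.map_smul, hf.map_hausdorffMeasure (Or.inl (by positivity)), Measure.restrict_smul]

theorem isometry_const_add {d n : ℕ} (p : EuclideanSpace ℝ (Fin n))
    (J : EuclideanSpace ℝ (Fin d) →ₗᵢ[ℝ] EuclideanSpace ℝ (Fin n)) :
    Isometry (fun v => p + J v) :=
  (IsometryEquiv.constVAdd p).isometry.comp J.isometry

/-! ### Flat approximations. -/

/-- `c · ℋᵈ` on the plane `p + range J` approximates `μ` in `ball y t`, with absolute error `ε`
on `1`-Lipschitz functions. -/
def FlatApprox {d n : ℕ} (μ : Measure (EuclideanSpace ℝ (Fin n))) (y : EuclideanSpace ℝ (Fin n))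
    (t : ℝ) (p : EuclideanSpace ℝ (Fin n))
    (J : EuclideanSpace ℝ (Fin d) →ₗᵢ[ℝ] EuclideanSpace ℝ (Fin n)) (c ε : ℝ) : Prop :=
  ∀ ψ : EuclideanSpace ℝ (Fin n) → ℝ, LipschitzWith 1 ψ → Function.support ψ ⊆ ball y t →
    |∫ z, ψ z ∂μ - c * ∫ v, ψ (p + J v) ∂(hausdorffN d d)| ≤ ε

theorem exists_isometry_range_eq {d n : ℕ} {V : AffineSubspace ℝ (EuclideanSpace ℝ (Fin n))}
    (hV : Module.finrank ℝ V.direction = d) {p : EuclideanSpace ℝ (Fin n)} (hp : p ∈ V) :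
    ∃ J : EuclideanSpace ℝ (Fin d) →ₗᵢ[ℝ] EuclideanSpace ℝ (Fin n),
      range (fun v => p + J v) = (V : Set (EuclideanSpace ℝ (Fin n))) := by
  let b := (stdOrthonormalBasis ℝ V.direction).reindex (finCongr hV)
  refine ⟨V.direction.subtypeₗᵢ.comp b.repr.symm.toLinearIsometry, ?_⟩
  ext z
  constructor
  · rintro ⟨v, rfl⟩
    have := AffineSubspace.vadd_mem_of_mem_direction (b.repr.symm v).2 hp
    simpa [add_comm] using this
  · intro hz
    refine ⟨b.repr ⟨z - p, AffineSubspace.vsub_mem_direction hz hp⟩, ?_⟩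
    simp

/-- A small local Wasserstein distance to a flat measure gives a flat approximation. -/
theorem FlatApprox.of_wassersteinBall_lt {d n : ℕ} {μ : Measure (EuclideanSpace ℝ (Fin n))}
    {y : EuclideanSpace ℝ (Fin n)} {t e : ℝ} (ht : 0 < t) (he : 0 ≤ e)
    (h0 : 0 < μ (ball y t)) (h1 : μ (ball y t) < ∞)
    {V : AffineSubspace ℝ (EuclideanSpace ℝ (Fin n))} (hV : V ∈ centralPlanes d n)
    (hW : wassersteinBall (rescaledMeasure μ y t) (flatMeasure d V) ≤ ENNReal.ofReal e) :
    ∃ (p : EuclideanSpace ℝ (Fin n))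
      (J : EuclideanSpace ℝ (Fin d) →ₗᵢ[ℝ] EuclideanSpace ℝ (Fin n)) (c : ℝ), 0 ≤ c ∧
      FlatApprox μ y t p J c (e * t * μ.real (ball y t)) := by
  obtain ⟨hVd, q, hqV, -⟩ := hV
  obtain ⟨J, hJ⟩ := exists_isometry_range_eq hVd hqV
  set m := μ.real (ball y t) with hm
  have hm0 : 0 < m := ENNReal.toReal_pos h0.ne' h1.ne
  set h := (hausdorffN d n ((V : Set (EuclideanSpace ℝ (Fin n))) ∩ ball 0 1))⁻¹.toReal with hh
  -- The unit-scale plane is carried back by u ↦ y + t u. The coefficient collects the mass of the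
  -- ball, the normalization of the flat measure and the Jacobian of the dilation of ℝᵈ.
  refine ⟨y + t • q, J, m * h * (t ^ d)⁻¹, by positivity, fun ψ hψ hsupp => ?_⟩
  set φ : EuclideanSpace ℝ (Fin n) → ℝ := fun u => t⁻¹ * ψ (y + t • u) with hφ
  have hφL : LipschitzWith 1 φ := by
    refine LipschitzWith.of_dist_le_mul fun u v => ?_
    have := hψ.dist_le_mul (y + t • u) (y + t • v)
    simp only [NNReal.coe_one, one_mul, dist_add_left, dist_smul₀, Real.norm_eq_abs,
      abs_of_pos ht] at this
    rw [hφ, Real.dist_eq] at *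
    simp only [NNReal.coe_one, one_mul]
    rw [← mul_sub, abs_mul, abs_of_pos (inv_pos.2 ht), inv_mul_le_iff₀ ht]
    exact this
  have hφs : Function.support φ ⊆ ball 0 1 := by
    intro u hu
    have : ψ (y + t • u) ≠ 0 := fun h0 => hu (by simp [hφ, h0])
    have := hsupp this
    simp only [mem_ball, dist_self_add_left, norm_smul, Real.norm_eq_abs, abs_of_pos ht] at this
    simpa using (mul_lt_iff_lt_one_right ht).1 this
  have key : ENNReal.ofReal |∫ z, φ z ∂(rescaledMeasure μ y t) - ∫ z, φ z ∂(flatMeasure d V)|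
      ≤ ENNReal.ofReal e :=
    by
    refine le_trans ?_ hW
    unfold wassersteinBall
    refine le_iSup₂_of_le φ hφL ?_
    rw [iSup_pos hφs]
  rw [ENNReal.ofReal_le_ofReal_iff he] at key
  have hcont : Continuous φ := hφL.continuous
  have e1 : ∫ z, φ z ∂(rescaledMeasure μ y t) = m⁻¹ * (t⁻¹ * ∫ z, ψ z ∂μ) := by
    have : ∀ z, φ (t⁻¹ • (z - y)) = t⁻¹ * ψ z := fun z => by simp [hφ, smul_smul, ht.ne']
    rw [rescaledMeasure, integral_smul_measure, integral_map
      (by fun_prop) hcont.aestronglyMeasurable, ENNReal.toReal_inv, smul_eq_mul]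
    simp_rw [this, integral_const_mul]
    rfl
  have e2 : ∫ z, φ z ∂(flatMeasure d V)
      = h * (t⁻¹ * ((t ^ d)⁻¹ * ∫ v, ψ (y + t • q + J v) ∂(hausdorffN d d))) := by
    rw [flatMeasure, integral_smul_measure, ← hJ, ← map_hausdorffN_of_isometry
      (isometry_const_add q J), integral_map (isometry_const_add q J).continuous.aemeasurable
      hcont.aestronglyMeasurable, hJ, smul_eq_mul, ← hh]
    have hsc := Measure.integral_comp_smul (hausdorffN d d) (fun v => ψ (y + t • q + J v)) t
    rw [finrank_euclideanSpace_fin, smul_eq_mul, abs_of_pos (by positivity)] at hsc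
    have : ∀ v, φ (q + J v) = t⁻¹ * ψ (y + t • q + J (t • v)) := fun v => by
      simp [hφ, smul_add, add_assoc]
    simp_rw [this, integral_const_mul, hsc]
  rw [e1, e2] at key
  have : ∫ z, ψ z ∂μ - m * h * (t ^ d)⁻¹ * ∫ v, ψ (y + t • q + J v) ∂(hausdorffN d d)
      = (t * m) * (m⁻¹ * (t⁻¹ * ∫ z, ψ z ∂μ) -
        h * (t⁻¹ * ((t ^ d)⁻¹ * ∫ v, ψ (y + t • q + J v) ∂(hausdorffN d d)))) := by
    field_simp
  rw [this, abs_mul, abs_of_pos (by positivity)]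
  calc _ ≤ t * m * e := by gcongr
    _ = _ := by ring

theorem FlatApprox.mono_ball {d n : ℕ} {μ : Measure (EuclideanSpace ℝ (Fin n))}
    {y y' p : EuclideanSpace ℝ (Fin n)} {t t' c ε ε' : ℝ}
    {J : EuclideanSpace ℝ (Fin d) →ₗᵢ[ℝ] EuclideanSpace ℝ (Fin n)}
    (h : FlatApprox μ y t p J c ε) (hb : ball y' t' ⊆ ball y t) (hε : ε ≤ ε') :
    FlatApprox μ y' t' p J c ε' :=
  fun ψ hψ hs => (h ψ hψ (hs.trans hb)).trans hε

theorem FlatApprox.translate {d n : ℕ} {μ : Measure (EuclideanSpace ℝ (Fin n))}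
    {y p : EuclideanSpace ℝ (Fin n)} {t c ε : ℝ}
    {J : EuclideanSpace ℝ (Fin d) →ₗᵢ[ℝ] EuclideanSpace ℝ (Fin n)}
    (h : FlatApprox μ y t p J c ε) (w : EuclideanSpace ℝ (Fin d)) :
    FlatApprox μ y t (p + J w) J c ε := by
  intro ψ hψ hs
  have := integral_add_left_eq_self (μ := hausdorffN d d) (fun v => ψ (p + J v)) w
  simp only [map_add, ← add_assoc] at this
  rw [this]
  exact h ψ hψ hs

/-! ### Tangential and normal components relative to a plane. -/

section Projection

variable {d n : ℕ}

/-- The coordinates of the orthogonal projection to the range of a linear isometry. -/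
noncomputable def coord (J : EuclideanSpace ℝ (Fin d) →ₗᵢ[ℝ] EuclideanSpace ℝ (Fin n)) :
    EuclideanSpace ℝ (Fin n) →L[ℝ] EuclideanSpace ℝ (Fin d) :=
  ContinuousLinearMap.adjoint J.toContinuousLinearMap

/-- The component of a vector orthogonal to the range of a linear isometry. -/
noncomputable def normalPart (J : EuclideanSpace ℝ (Fin d) →ₗᵢ[ℝ] EuclideanSpace ℝ (Fin n)) :
    EuclideanSpace ℝ (Fin n) →L[ℝ] EuclideanSpace ℝ (Fin n) :=
  ContinuousLinearMap.id ℝ _ - J.toContinuousLinearMap.comp (coord J)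

variable (J : EuclideanSpace ℝ (Fin d) →ₗᵢ[ℝ] EuclideanSpace ℝ (Fin n))

theorem normalPart_apply (z : EuclideanSpace ℝ (Fin n)) :
    normalPart J z = z - J (coord J z) := rfl

@[simp]
theorem coord_map (v : EuclideanSpace ℝ (Fin d)) : coord J (J v) = v := by
  refine ext_inner_right ℝ fun w => ?_
  rw [coord, ContinuousLinearMap.adjoint_inner_left]
  exact J.inner_map_map v w

@[simp]
theorem normalPart_map (v : EuclideanSpace ℝ (Fin d)) : normalPart J (J v) = 0 := by
  simp [normalPart_apply]

@[simp]
theorem coord_normalPart (z : EuclideanSpace ℝ (Fin n)) : coord J (normalPart J z) = 0 := by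
  simp [normalPart_apply]

theorem norm_sq_eq_coord_add_normalPart (z : EuclideanSpace ℝ (Fin n)) :
    ‖z‖ ^ 2 = ‖coord J z‖ ^ 2 + ‖normalPart J z‖ ^ 2 := by
  have h : inner ℝ (J (coord J z)) (normalPart J z) = 0 := by
    have := ContinuousLinearMap.adjoint_inner_right J.toContinuousLinearMap
      (coord J z) (normalPart J z)
    rw [← coord, coord_normalPart, inner_zero_right] at this
    exact this.symm
  have h2 := norm_add_sq_real (J (coord J z)) (normalPart J z)
  rw [h, normalPart_apply, add_sub_cancel, J.norm_map, ← normalPart_apply] at h2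
  linarith

theorem norm_coord_le (z : EuclideanSpace ℝ (Fin n)) : ‖coord J z‖ ≤ ‖z‖ := by
  have := norm_sq_eq_coord_add_normalPart J z
  exact le_of_sq_le_sq (by nlinarith [sq_nonneg ‖normalPart J z‖]) (norm_nonneg _)

theorem norm_normalPart_le (z : EuclideanSpace ℝ (Fin n)) : ‖normalPart J z‖ ≤ ‖z‖ := by
  have := norm_sq_eq_coord_add_normalPart J z
  exact le_of_sq_le_sq (by nlinarith [sq_nonneg ‖coord J z‖]) (norm_nonneg _)

theorem norm_le_coord_add_normalPart (z : EuclideanSpace ℝ (Fin n)) :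
    ‖z‖ ≤ ‖coord J z‖ + ‖normalPart J z‖ := by
  conv_lhs => rw [show z = J (coord J z) + normalPart J z by simp [normalPart_apply]]
  exact (norm_add_le _ _).trans (by rw [J.norm_map])

variable {J} {y p : EuclideanSpace ℝ (Fin n)}

/-- Pythagoras: the hypothesis says that `p` is the foot of the perpendicular from `y`. -/
theorem dist_sq_of_coord_eq_zero (h : coord J (y - p) = 0) (v : EuclideanSpace ℝ (Fin d)) :
    dist (p + J v) y ^ 2 = ‖v‖ ^ 2 + ‖y - p‖ ^ 2 := by
  have e : p + J v - y = J v - (y - p) := by abel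
  rw [dist_eq_norm, e, norm_sq_eq_coord_add_normalPart J (J v - (y - p)),
    norm_sq_eq_coord_add_normalPart J (y - p)]
  rw [map_sub (coord J) (J v), map_sub (normalPart J) (J v), h]
  simp only [coord_map, normalPart_map, sub_zero, zero_sub, norm_neg, norm_zero]
  ring

theorem norm_le_dist_of_coord_eq_zero (h : coord J (y - p) = 0) (v : EuclideanSpace ℝ (Fin d)) :
    ‖v‖ ≤ dist (p + J v) y := by
  have := dist_sq_of_coord_eq_zero h v
  exact le_of_sq_le_sq (by nlinarith [sq_nonneg ‖y - p‖]) dist_nonneg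

theorem dist_le_norm_add (v : EuclideanSpace ℝ (Fin d)) :
    dist (p + J v) y ≤ ‖v‖ + ‖y - p‖ := by
  rw [dist_eq_norm, show p + J v - y = J v - (y - p) by abel]
  exact (norm_sub_le _ _).trans (by rw [J.norm_map])

theorem normalPart_of_coord_eq_zero {z : EuclideanSpace ℝ (Fin n)} (h : coord J z = 0) :
    normalPart J z = z := by
  simp [normalPart_apply, h]

end Projection

/-! ### Integral bounds and tent functions. -/

section Integrals

theorem integrable_of_support_subset_ball {X : Type*} [MetricSpace X] [ProperSpace X]
    [MeasurableSpace X] [BorelSpace X] {μ : Measure X} [IsFiniteMeasureOnCompacts μ] {g : X → ℝ}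
    (hg : Continuous g) {y : X} {t : ℝ} (hs : Function.support g ⊆ closedBall y t) :
    Integrable g μ :=
  hg.integrable_of_hasCompactSupport
    (HasCompactSupport.of_support_subset_isCompact (isCompact_closedBall y t) hs)

theorem mul_measureReal_le_integral {X : Type*} [MeasurableSpace X] {μ : Measure X} {g : X → ℝ}
    (hg : Integrable g μ) (h0 : ∀ x, 0 ≤ g x) {S : Set X} (hS : MeasurableSet S) (hS' : μ S ≠ ∞)
    {a : ℝ} (ha : ∀ x ∈ S, a ≤ g x) : a * μ.real S ≤ ∫ x, g x ∂μ := by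
  calc a * μ.real S = ∫ x in S, a ∂μ := by simp [mul_comm]
    _ ≤ ∫ x in S, g x ∂μ := setIntegral_mono_on
        (integrableOn_const hS') hg.integrableOn hS ha
    _ ≤ ∫ x, g x ∂μ := setIntegral_le_integral hg (.of_forall h0)

theorem integral_le_mul_measureReal {X : Type*} [MeasurableSpace X] {μ : Measure X} {g : X → ℝ}
    (hg : Integrable g μ) {S : Set X} (hS : MeasurableSet S) (hS' : μ S ≠ ∞)
    {a : ℝ} (ha : ∀ x, g x ≤ a) (hgS : Function.support g ⊆ S) : ∫ x, g x ∂μ ≤ a * μ.real S := by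
  calc ∫ x, g x ∂μ = ∫ x in S, g x ∂μ := (setIntegral_eq_integral_of_forall_compl_eq_zero
        fun x hx => Function.notMem_support.1 fun h => hx (hgS h)).symm
    _ ≤ ∫ x in S, a ∂μ := setIntegral_mono_on hg.integrableOn
        (integrableOn_const hS') hS fun x _ => ha x
    _ = a * μ.real S := by simp [mul_comm]

/-- The tent function of height `t` on `ball y t`. -/
noncomputable def tent {X : Type*} [PseudoMetricSpace X] (y : X) (t : ℝ) (z : X) : ℝ :=
  max 0 (t - dist z y)

variable {X : Type*} [PseudoMetricSpace X] (y : X) (t : ℝ)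

theorem tent_nonneg (z : X) : 0 ≤ tent y t z := le_max_left _ _

theorem le_tent (z : X) : t - dist z y ≤ tent y t z := le_max_right _ _

theorem tent_le (ht : 0 ≤ t) (z : X) : tent y t z ≤ t :=
  max_le ht (by linarith [dist_nonneg (x := z) (y := y)])

theorem tent_eq_zero {z : X} (hz : t ≤ dist z y) : tent y t z = 0 := max_eq_left (by linarith)

theorem support_tent : Function.support (tent y t) ⊆ ball y t := fun z hz => by
  by_contra h
  exact hz (tent_eq_zero y t (by simpa using h))

theorem lipschitzWith_tent : LipschitzWith 1 (tent y t) := by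
  have h : LipschitzWith 1 fun z : X => t - dist z y :=
    LipschitzWith.of_dist_le_mul fun u v => by
      rw [Real.dist_eq, sub_sub_sub_cancel_left, NNReal.coe_one, one_mul, abs_sub_comm]
      exact abs_dist_sub_le u v y
  exact h.const_max 0

end Integrals

/-! ### Consequences of testing a flat approximation. -/

section Approx

variable {d n : ℕ} {μ : Measure (EuclideanSpace ℝ (Fin n))} [IsLocallyFiniteMeasure μ]
  {y p p₁ p₂ : EuclideanSpace ℝ (Fin n)} {t c c₁ c₂ ε : ℝ}
  {J J₁ J₂ : EuclideanSpace ℝ (Fin d) →ₗᵢ[ℝ] EuclideanSpace ℝ (Fin n)}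

-- Sliding the base point along the plane costs nothing, by translation invariance of ℋᵈ on ℝᵈ.
-- Later estimates may thus take it to be the foot of the perpendicular from the centre.
omit [IsLocallyFiniteMeasure μ] in
theorem FlatApprox.recenter (h : FlatApprox μ y t p J c ε) (x : EuclideanSpace ℝ (Fin n)) :
    FlatApprox μ y t (p + J (coord J (x - p))) J c ε ∧
      coord J (x - (p + J (coord J (x - p)))) = 0 ∧
      ‖x - (p + J (coord J (x - p)))‖ = ‖normalPart J (x - p)‖ := by
  have h2 : coord J (x - (p + J (coord J (x - p)))) = 0 := by
    rw [← sub_sub]; simp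
  refine ⟨h.translate _, h2, ?_⟩
  rw [normalPart_apply, sub_sub]

theorem support_comp_plane_subset {ψ : EuclideanSpace ℝ (Fin n) → ℝ}
    (hs : Function.support ψ ⊆ ball y t) (p : EuclideanSpace ℝ (Fin n))
    (J : EuclideanSpace ℝ (Fin d) →ₗᵢ[ℝ] EuclideanSpace ℝ (Fin n)) :
    Function.support (fun v => ψ (p + J v)) ⊆ closedBall 0 (t + ‖y - p‖) := by
  intro v hv
  have h1 : dist (p + J v) y < t := hs hv
  have h2 : ‖v‖ ≤ ‖p + J v - y‖ + ‖y - p‖ := by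
    have := norm_add_le (p + J v - y) (y - p)
    rwa [show p + J v - y + (y - p) = J v by abel, J.norm_map] at this
  rw [dist_eq_norm] at h1
  simp only [mem_closedBall, dist_zero_right]
  linarith

theorem integrable_comp_plane {ψ : EuclideanSpace ℝ (Fin n) → ℝ} (hψ : Continuous ψ)
    (hs : Function.support ψ ⊆ ball y t) (p : EuclideanSpace ℝ (Fin n))
    (J : EuclideanSpace ℝ (Fin d) →ₗᵢ[ℝ] EuclideanSpace ℝ (Fin n)) :
    Integrable (fun v => ψ (p + J v)) (hausdorffN d d) :=
  integrable_of_support_subset_ball (hψ.comp (isometry_const_add p J).continuous)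
    (support_comp_plane_subset hs p J)

/-- A ball that carries enough mass meets the approximating plane. -/
theorem FlatApprox.norm_normalPart_lt (h : FlatApprox μ y t p J c ε) {z : EuclideanSpace ℝ (Fin n)}
    {δ : ℝ} (hb : ball z (2 * δ) ⊆ ball y t) (hε : ε < δ * μ.real (ball z δ)) :
    ‖normalPart J (z - p)‖ < 2 * δ := by
  by_contra! hcon
  -- A tent of radius `2 * δ` around a point at least that far from the plane is invisible to the
  -- plane, while `μ` gives it integral at least δ·μ(B(z,δ)).
  have h0 : ∀ v, tent z (2 * δ) (p + J v) = 0 := by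
    refine fun v => tent_eq_zero _ _ (hcon.trans ?_)
    have : normalPart J (z - p) = normalPart J (z - (p + J v)) := by
      rw [← sub_sub, map_sub _ (z - p), normalPart_map, sub_zero]
    rw [this, dist_comm, dist_eq_norm]
    exact norm_normalPart_le _ _
  have h1 := h _ (lipschitzWith_tent z (2 * δ)) ((support_tent z (2 * δ)).trans hb)
  simp only [h0, integral_zero, mul_zero, sub_zero] at h1
  have h2 := mul_measureReal_le_integral (μ := μ) (g := tent z (2 * δ)) (S := ball z δ) (a := δ)
    (integrable_of_support_subset_ball (lipschitzWith_tent z (2 * δ)).continuous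
      ((support_tent z (2 * δ)).trans ball_subset_closedBall)) (tent_nonneg z _) measurableSet_ball
    measure_ball_lt_top.ne (fun x hx => by
      have := le_tent z (2 * δ) x
      have := mem_ball.1 hx
      linarith)
  linarith [le_abs_self (∫ z', tent z (2 * δ) z' ∂μ)]

theorem integral_tent_plane_le (ht : 0 < t) (hp : coord J (y - p) = 0) :
    ∫ v, tent y t (p + J v) ∂(hausdorffN d d) ≤ t * t ^ d := by
  rw [← hausdorffN_real_ball (0 : EuclideanSpace ℝ (Fin d)) ht]
  refine integral_le_mul_measureReal
    (integrable_comp_plane (lipschitzWith_tent y t).continuous (support_tent y t) p J)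
    measurableSet_ball measure_ball_lt_top.ne (fun v => tent_le y t ht.le _) fun v hv => ?_
  have : dist (p + J v) y < t := support_tent y t hv
  simpa using (norm_le_dist_of_coord_eq_zero hp v).trans_lt this

theorem le_integral_tent_plane (ht : 0 < t) (hD : ‖y - p‖ ≤ t / 4) :
    t / 2 * (t / 4) ^ d ≤ ∫ v, tent y t (p + J v) ∂(hausdorffN d d) := by
  rw [← hausdorffN_real_ball (0 : EuclideanSpace ℝ (Fin d)) (show 0 < t / 4 by positivity)]
  refine mul_measureReal_le_integral
    (integrable_comp_plane (lipschitzWith_tent y t).continuous (support_tent y t) p J)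
    (fun v => tent_nonneg y t _) measurableSet_ball measure_ball_lt_top.ne fun v hv => ?_
  have h1 := le_tent y t (p + J v)
  have h2 := dist_le_norm_add (J := J) (y := y) (p := p) v
  rw [mem_ball, dist_zero_right] at hv
  linarith

/-- The plane passes within t/4 of `y`, so its tent integral is at least (t/2)(t/4)ᵈ, whereas the
`μ`-integral of the tent is at most t·μ(B(y,t)). -/
theorem FlatApprox.coeff_le (h : FlatApprox μ y t p J c ε) (ht : 0 < t) (hc : 0 ≤ c)
    (hD : ‖y - p‖ ≤ t / 4) (hε : ε ≤ t * μ.real (ball y t)) :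
    c * t ^ d ≤ 4 * 4 ^ d * μ.real (ball y t) := by
  have h1 := h _ (lipschitzWith_tent y t) (support_tent y t)
  have h2 := mul_le_mul_of_nonneg_left (le_integral_tent_plane (J := J) ht hD) hc
  have h3 : ∫ z, tent y t z ∂μ ≤ t * μ.real (ball y t) :=
    integral_le_mul_measureReal (integrable_of_support_subset_ball
      (lipschitzWith_tent y t).continuous ((support_tent y t).trans ball_subset_closedBall))
      measurableSet_ball measure_ball_lt_top.ne (tent_le y t ht.le) (support_tent y t)
  have h4 : c * (t / 2 * (t / 4) ^ d) ≤ 2 * (t * μ.real (ball y t)) := by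
    linarith [(abs_le.1 h1).1]
  rw [div_pow] at h4
  have h5 : c * (t / 2 * (t ^ d / 4 ^ d)) = t * (c * t ^ d) / (2 * 4 ^ d) := by
    field_simp
  rw [h5, div_le_iff₀ (by positivity)] at h4
  nlinarith

/-- The tent is at least t/2 on the half ball, which by doubling holds a fixed share of the mass.
The condition on `ε` absorbs the error into half of the left-hand side. -/
theorem FlatApprox.le_coeff (h : FlatApprox μ y t p J c ε) (ht : 0 < t) (hc : 0 ≤ c)
    (hp : coord J (y - p) = 0) {C : ℝ} (hC : 0 < C)
    (hd : μ.real (ball y t) ≤ C * μ.real (ball y (t / 2)))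
    (hε : 4 * C * ε ≤ t * μ.real (ball y t)) :
    μ.real (ball y t) ≤ 4 * C * (c * t ^ d) := by
  have h1 := h _ (lipschitzWith_tent y t) (support_tent y t)
  have h2 := mul_le_mul_of_nonneg_left (integral_tent_plane_le ht hp) hc
  have h3 : t / 2 * μ.real (ball y (t / 2)) ≤ ∫ z, tent y t z ∂μ :=
    mul_measureReal_le_integral (integrable_of_support_subset_ball
      (lipschitzWith_tent y t).continuous ((support_tent y t).trans ball_subset_closedBall))
      (tent_nonneg y t) measurableSet_ball measure_ball_lt_top.ne fun z hz => by
        have := le_tent y t z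
        have := mem_ball.1 hz
        linarith
  have h4 : t / 2 * μ.real (ball y (t / 2)) ≤ ε + c * (t * t ^ d) := by
    linarith [(abs_le.1 h1).2]
  have h5 := mul_le_mul_of_nonneg_left h4 hC.le
  have h6 : t * μ.real (ball y t) ≤ t * (4 * C * (c * t ^ d)) := by nlinarith
  exact le_of_mul_le_mul_left h6 ht

omit [IsLocallyFiniteMeasure μ] in
/-- Two planes that approximate the same measure are close to each other. -/
theorem FlatApprox.norm_normalPart_le_of_approx (h₁ : FlatApprox μ y t p₁ J₁ c₁ ε)
    (h₂ : FlatApprox μ y t p₂ J₂ c₂ ε) (ht : 0 < t) (hc₂ : 0 ≤ c₂)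
    (hD₂ : ‖y - p₂‖ ≤ t / 4) {m A e : ℝ} (hA : 0 ≤ A)
    (hε : ε = e * t * m) (hm : 0 < m) (hmc : m ≤ A * (c₂ * t ^ d))
    (hsmall : 4 * 4 ^ d * A * e < 1 / 4) {v : EuclideanSpace ℝ (Fin d)} (hv : ‖v‖ ≤ t / 4) :
    ‖normalPart J₁ (p₂ + J₂ v - p₁)‖ ≤ 4 * 4 ^ d * A * e * t := by
  set q : EuclideanSpace ℝ (Fin n) → ℝ := fun z => ‖normalPart J₁ (z - p₁)‖ with hq
  have hqL : LipschitzWith 1 q := LipschitzWith.of_dist_le_mul fun u w => by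
    rw [NNReal.coe_one, one_mul, Real.dist_eq, dist_eq_norm]
    refine (abs_norm_sub_norm_le _ _).trans ?_
    rw [← map_sub, sub_sub_sub_cancel_right]
    exact norm_normalPart_le _ _
  -- Distance to the first plane, localized by a tent. It vanishes on that plane, so both
  -- approximations together force a small integral over the second plane.
  set ψ : EuclideanSpace ℝ (Fin n) → ℝ := fun z => min (q z) (tent y t z) with hψ
  have hψL : LipschitzWith 1 ψ := by
    simpa using hqL.min (lipschitzWith_tent y t)
  have hψ0 : ∀ z, 0 ≤ ψ z := fun z => le_min (norm_nonneg _) (tent_nonneg y t z)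
  have hψs : Function.support ψ ⊆ ball y t := fun z hz => support_tent y t fun h0 => hz (by
    simp only [hψ, h0]; exact min_eq_right (norm_nonneg _))
  have k1 := h₁ ψ hψL hψs
  have k2 := h₂ ψ hψL hψs
  have hz : ∀ w, ψ (p₁ + J₁ w) = 0 := fun w => by
    have : q (p₁ + J₁ w) = 0 := by simp [hq]
    simp only [hψ, this]
    exact min_eq_left (tent_nonneg _ _ _)
  simp only [hz, integral_zero, mul_zero, sub_zero] at k1
  set I := ∫ v, ψ (p₂ + J₂ v) ∂(hausdorffN d d) with hI
  have k3 : c₂ * I ≤ 2 * ε := by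
    linarith [(abs_le.1 k1).2, (abs_le.1 k2).1]
  set M := min (q (p₂ + J₂ v)) (t / 4) with hM
  have hM0 : 0 ≤ M := le_min (norm_nonneg _) (by positivity)
  have hint := integrable_comp_plane hψL.continuous hψs p₂ J₂
  have hadd : ∫ w, ψ (p₂ + J₂ (v + w)) ∂(hausdorffN d d) = I :=
    integral_add_left_eq_self (μ := hausdorffN d d) (fun w => ψ (p₂ + J₂ w)) v
  have hsub : ∫ w, ψ (p₂ + J₂ (v - w)) ∂(hausdorffN d d) = I :=
    integral_sub_left_eq_self (fun w => ψ (p₂ + J₂ w)) (hausdorffN d d) v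
  have hint1 : Integrable (fun w => ψ (p₂ + J₂ (v + w))) (hausdorffN d d) := hint.comp_add_left v
  have hint2 : Integrable (fun w => ψ (p₂ + J₂ (v - w))) (hausdorffN d d) := hint.comp_sub_left v
  -- An integral bound becomes a pointwise one by symmetrizing about `v`: the distance to a plane is
  -- convex, so its values at v + w and v - w add up to at least twice the value at v.
  have hlow : M * (hausdorffN d d).real (ball 0 (t / 4)) ≤
      ∫ w, (ψ (p₂ + J₂ (v + w)) + ψ (p₂ + J₂ (v - w))) ∂(hausdorffN d d) := by
    refine mul_measureReal_le_integral (hint1.add hint2) (fun w => add_nonneg (hψ0 _) (hψ0 _))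
      measurableSet_ball measure_ball_lt_top.ne fun w hw => ?_
    rw [mem_ball, dist_zero_right] at hw
    have ht1 : ∀ u : EuclideanSpace ℝ (Fin d), ‖u‖ ≤ t / 2 → t / 4 ≤ tent y t (p₂ + J₂ u) := by
      intro u hu
      have h1 := le_tent y t (p₂ + J₂ u)
      have h2 := dist_le_norm_add (J := J₂) (y := y) (p := p₂) u
      linarith
    have hw1 := ht1 (v + w) ((norm_add_le _ _).trans (by linarith))
    have hw2 := ht1 (v - w) ((norm_sub_le _ _).trans (by linarith))
    have hmid : 2 * q (p₂ + J₂ v) ≤ q (p₂ + J₂ (v + w)) + q (p₂ + J₂ (v - w)) := by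
      have : (2 : ℝ) • (p₂ + J₂ v - p₁)
          = (p₂ + J₂ (v + w) - p₁) + (p₂ + J₂ (v - w) - p₁) := by
        rw [two_smul, map_add, map_sub]; abel
      calc 2 * q (p₂ + J₂ v) = ‖normalPart J₁ ((2 : ℝ) • (p₂ + J₂ v - p₁))‖ := by
            rw [map_smul, norm_smul]; simp [hq]
        _ ≤ _ := by rw [this, map_add]; exact norm_add_le _ _
    have g0 : 0 ≤ q (p₂ + J₂ (v + w)) := norm_nonneg _
    have g1 : 0 ≤ q (p₂ + J₂ (v - w)) := norm_nonneg _
    have hMq : M ≤ q (p₂ + J₂ v) := min_le_left _ _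
    have hMt : M ≤ t / 4 := min_le_right _ _
    have i1 : min (q (p₂ + J₂ (v + w))) (t / 4) ≤ ψ (p₂ + J₂ (v + w)) := min_le_min_left _ hw1
    have i2 : min (q (p₂ + J₂ (v - w))) (t / 4) ≤ ψ (p₂ + J₂ (v - w)) := min_le_min_left _ hw2
    change M ≤ ψ (p₂ + J₂ (v + w)) + ψ (p₂ + J₂ (v - w))
    rcases min_cases (q (p₂ + J₂ (v + w))) (t / 4) with ⟨e1, _⟩ | ⟨e1, _⟩ <;>
    rcases min_cases (q (p₂ + J₂ (v - w))) (t / 4) with ⟨e2, _⟩ | ⟨e2, _⟩ <;>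
    linarith
  rw [integral_add hint1 hint2, hadd, hsub, hausdorffN_real_ball _ (by positivity), div_pow] at hlow
  have k4 : M * (c₂ * t ^ d) ≤ 4 * 4 ^ d * ε := by
    have : c₂ * (M * (t ^ d / 4 ^ d)) ≤ c₂ * (I + I) := by gcongr
    have e1 : c₂ * (M * (t ^ d / 4 ^ d)) = M * (c₂ * t ^ d) / 4 ^ d := by ring
    rw [e1, div_le_iff₀ (by positivity)] at this
    nlinarith [pow_pos (show (0 : ℝ) < 4 by norm_num) d]
  have k5 : M ≤ 4 * 4 ^ d * A * e * t := by
    have : M * m ≤ 4 * 4 ^ d * A * e * t * m := by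
      calc M * m ≤ M * (A * (c₂ * t ^ d)) := by gcongr
        _ = A * (M * (c₂ * t ^ d)) := by ring
        _ ≤ A * (4 * 4 ^ d * ε) := by gcongr
        _ = _ := by rw [hε]; ring
    exact le_of_mul_le_mul_right this hm
  -- The truncation at t/4 is inactive, because `hsmall` puts the bound strictly below t/4.
  rcases min_cases (q (p₂ + J₂ v)) (t / 4) with ⟨e1, _⟩ | ⟨e1, _⟩
  · rw [hM, e1] at k5
    exact k5
  · rw [hM, e1] at k5
    nlinarith

-- The bound for points of the second plane is applied at 0 and at the multiple of `v` of length
-- t/4; the base points cancel in the difference.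
omit [IsLocallyFiniteMeasure μ] in
theorem FlatApprox.norm_normalPart_map_le (h₁ : FlatApprox μ y t p₁ J₁ c₁ ε)
    (h₂ : FlatApprox μ y t p₂ J₂ c₂ ε) (ht : 0 < t) (hc₂ : 0 ≤ c₂)
    (hD₂ : ‖y - p₂‖ ≤ t / 4) {m A e : ℝ} (hA : 0 ≤ A)
    (hε : ε = e * t * m) (hm : 0 < m) (hmc : m ≤ A * (c₂ * t ^ d))
    (hsmall : 4 * 4 ^ d * A * e < 1 / 4) (v : EuclideanSpace ℝ (Fin d)) :
    ‖normalPart J₁ (J₂ v)‖ ≤ 32 * 4 ^ d * A * e * ‖v‖ := by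
  rcases eq_or_ne v 0 with rfl | hv
  · simp
  have hv0 : 0 < ‖v‖ := norm_pos_iff.2 hv
  set s : ℝ := t / 4 / ‖v‖ with hs
  have hs0 : 0 < s := by positivity
  have hsv : ‖s • v‖ = t / 4 := by
    rw [norm_smul, Real.norm_of_nonneg hs0.le, hs]; field_simp
  have k1 := h₁.norm_normalPart_le_of_approx h₂ ht hc₂ hD₂ hA hε hm hmc hsmall hsv.le
  have k2 := h₁.norm_normalPart_le_of_approx h₂ ht hc₂ hD₂ hA hε hm hmc hsmall
    (v := 0) (by simpa using (by positivity : (0 : ℝ) ≤ t / 4))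
  have e1 : s • J₂ v = (p₂ + J₂ (s • v) - p₁) - (p₂ + J₂ 0 - p₁) := by simp
  have k3 : s * ‖normalPart J₁ (J₂ v)‖ ≤ 2 * (4 * 4 ^ d * A * e * t) := by
    calc s * ‖normalPart J₁ (J₂ v)‖ = ‖normalPart J₁ (s • J₂ v)‖ := by
          rw [map_smul, norm_smul, Real.norm_of_nonneg hs0.le]
      _ ≤ _ := by
          rw [e1, map_sub]
          exact (norm_sub_le _ _).trans (by linarith)
  have e2 : t = 4 * (s * ‖v‖) := by rw [hs]; field_simp
  have k4 : s * ‖normalPart J₁ (J₂ v)‖ ≤ s * (32 * 4 ^ d * A * e * ‖v‖) := by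
    calc _ ≤ _ := k3
      _ = 2 * (4 * 4 ^ d * A * e * (4 * (s * ‖v‖))) := by rw [← e2]
      _ = _ := by ring
  exact le_of_mul_le_mul_left k4 hs0

/-- With `p₁`, `p₂` the feet of the perpendiculars from `y`, the distance from `y` to the point with
parameter v is √(‖v‖² + height²), which is 1-Lipschitz in the height. The directions of the planes
play no role. -/
theorem abs_integral_tent_plane_sub_le (ht : 0 < t) (hp₁ : coord J₁ (y - p₁) = 0)
    (hp₂ : coord J₂ (y - p₂) = 0) :
    |∫ v, tent y t (p₁ + J₁ v) ∂(hausdorffN d d) - ∫ v, tent y t (p₂ + J₂ v) ∂(hausdorffN d d)|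
      ≤ |‖y - p₁‖ - ‖y - p₂‖| * t ^ d := by
  have i1 := integrable_comp_plane (lipschitzWith_tent y t).continuous (support_tent y t) p₁ J₁
  have i2 := integrable_comp_plane (lipschitzWith_tent y t).continuous (support_tent y t) p₂ J₂
  rw [← integral_sub i1 i2]
  refine abs_integral_le_integral_abs.trans ?_
  rw [← hausdorffN_real_ball (0 : EuclideanSpace ℝ (Fin d)) ht]
  refine integral_le_mul_measureReal (i1.sub i2).abs measurableSet_ball measure_ball_lt_top.ne
    (fun v => ?_) fun v hv => ?_
  · refine (abs_max_sub_max_le_max _ _ _ _).trans ?_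
    rw [sub_self, abs_zero, sub_sub_sub_cancel_left]
    refine max_le (abs_nonneg _) ?_
    have e1 := dist_sq_of_coord_eq_zero hp₁ v
    have e2 := dist_sq_of_coord_eq_zero hp₂ v
    set a := dist (p₁ + J₁ v) y
    set b := dist (p₂ + J₂ v) y
    have ha : 0 ≤ a := dist_nonneg
    have hb : 0 ≤ b := dist_nonneg
    set α := ‖y - p₁‖
    set β := ‖y - p₂‖
    have hα : 0 ≤ α := norm_nonneg _
    have hβ : 0 ≤ β := norm_nonneg _
    have haα : α ≤ a := le_of_sq_le_sq (by nlinarith [sq_nonneg ‖v‖]) ha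
    have hbβ : β ≤ b := le_of_sq_le_sq (by nlinarith [sq_nonneg ‖v‖]) hb
    have e3 : (b - a) * (b + a) = (β - α) * (β + α) := by nlinarith
    rcases eq_or_lt_of_le (add_nonneg hb ha) with h0 | h0
    · have : a = 0 := by linarith
      have : b = 0 := by linarith
      rw [show b - a = 0 by linarith, abs_zero]; exact abs_nonneg _
    · have e4 : |b - a| * (b + a) = |β - α| * (β + α) := by
        rw [← abs_of_nonneg h0.le, ← abs_mul, e3, abs_mul, abs_of_nonneg (add_nonneg hβ hα)]
      have e5 : |b - a| * (b + a) ≤ |α - β| * (b + a) := by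
        rw [e4, abs_sub_comm]; gcongr
      exact le_of_mul_le_mul_right e5 h0
  · rw [mem_ball, dist_zero_right]
    by_contra! hcon
    refine hv ?_
    have z1 := tent_eq_zero y t (hcon.trans (norm_le_dist_of_coord_eq_zero hp₁ v))
    have z2 := tent_eq_zero y t (hcon.trans (norm_le_dist_of_coord_eq_zero hp₂ v))
    simp [z1, z2]

-- Both approximations are applied to the same tent. The `μ`-integrals cancel, and the two plane
-- integrals differ only through the heights of `y` over the planes, which are close because the
-- planes are.
omit [IsLocallyFiniteMeasure μ] in
theorem FlatApprox.abs_coeff_sub_le (h₁ : FlatApprox μ y t p₁ J₁ c₁ ε)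
    (h₂ : FlatApprox μ y t p₂ J₂ c₂ ε) (ht : 0 < t) (hc₁ : 0 ≤ c₁) (hc₂ : 0 ≤ c₂)
    (hp₁ : coord J₁ (y - p₁) = 0) (hp₂ : coord J₂ (y - p₂) = 0)
    (hD₁ : ‖y - p₁‖ ≤ t / 4) (hD₂ : ‖y - p₂‖ ≤ t / 4) {m A B e : ℝ} (hA : 0 ≤ A) (hB : 0 ≤ B)
    (he : 0 ≤ e) (hε : ε = e * t * m) (hm : 0 < m) (hmc₁ : m ≤ A * (c₁ * t ^ d))
    (hmc₂ : m ≤ A * (c₂ * t ^ d)) (hcm₂ : c₂ * t ^ d ≤ B * m)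
    (hsmall : 4 * 4 ^ d * A * e < 1 / 4) :
    |c₁ - c₂| ≤ 2 * 4 ^ d * (2 + B * (4 * 4 ^ d * A)) * A * e * c₁ := by
  set K := 4 * 4 ^ d * A with hK
  have k1 := h₁.norm_normalPart_le_of_approx h₂ ht hc₂ hD₂ hA hε hm hmc₂ hsmall
    (v := 0) (by simpa using (by positivity : (0 : ℝ) ≤ t / 4))
  have k2 := h₂.norm_normalPart_le_of_approx h₁ ht hc₁ hD₁ hA hε hm hmc₁ hsmall
    (v := 0) (by simpa using (by positivity : (0 : ℝ) ≤ t / 4))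
  rw [map_zero, add_zero, ← hK] at k1 k2
  have hdist : ∀ {J : EuclideanSpace ℝ (Fin d) →ₗᵢ[ℝ] EuclideanSpace ℝ (Fin n)}
      {p q : EuclideanSpace ℝ (Fin n)}, coord J (y - p) = 0 →
      ‖y - p‖ ≤ ‖y - q‖ + ‖normalPart J (q - p)‖ := by
    intro J p q hp
    rw [← normalPart_of_coord_eq_zero hp, ← sub_add_sub_cancel y q p, map_add]
    exact (norm_add_le _ _).trans (by gcongr; exact norm_normalPart_le _ _)
  have k3 : |‖y - p₁‖ - ‖y - p₂‖| ≤ K * e * t := by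
    rw [abs_sub_le_iff]
    constructor
    · linarith [hdist (q := p₂) hp₁]
    · linarith [hdist (q := p₁) hp₂]
  have k4 := abs_integral_tent_plane_sub_le ht hp₁ hp₂
  have k5 := le_integral_tent_plane (J := J₁) ht hD₁
  have k6 := h₁ _ (lipschitzWith_tent y t) (support_tent y t)
  have k7 := h₂ _ (lipschitzWith_tent y t) (support_tent y t)
  set I₁ := ∫ v, tent y t (p₁ + J₁ v) ∂(hausdorffN d d)
  set I₂ := ∫ v, tent y t (p₂ + J₂ v) ∂(hausdorffN d d)
  set I := ∫ z, tent y t z ∂μ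
  have hI₁ : 0 ≤ I₁ := le_trans (by positivity) k5
  have k8 : |c₁ - c₂| * I₁ ≤ 2 * ε + c₂ * (K * e * t * t ^ d) := by
    have e1 : (c₁ - c₂) * I₁ = (I - c₂ * I₂) - (I - c₁ * I₁) - c₂ * (I₁ - I₂) := by ring
    calc |c₁ - c₂| * I₁ = |(c₁ - c₂) * I₁| := by rw [abs_mul, abs_of_nonneg hI₁]
      _ ≤ |I - c₂ * I₂| + |I - c₁ * I₁| + |c₂ * (I₁ - I₂)| := by
          rw [e1]
          exact (abs_sub _ _).trans (add_le_add_left (abs_sub _ _) _)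
      _ ≤ ε + ε + c₂ * (K * e * t * t ^ d) := by
          rw [abs_mul, abs_of_nonneg hc₂]
          gcongr
          exact k4.trans (by gcongr)
      _ = _ := by ring
  have k9 : |c₁ - c₂| * (t / 2 * (t / 4) ^ d) ≤ (2 + B * K) * e * t * m := by
    calc _ ≤ |c₁ - c₂| * I₁ := by gcongr
      _ ≤ 2 * ε + K * e * t * (c₂ * t ^ d) := by linarith
      _ ≤ 2 * (e * t * m) + K * e * t * (B * m) := by rw [hε]; gcongr
      _ = _ := by ring
  have k10 : |c₁ - c₂| * (t / 2 * (t / 4) ^ d)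
      ≤ (2 * 4 ^ d * (2 + B * K) * A * e * c₁) * (t / 2 * (t / 4) ^ d) := by
    refine k9.trans ?_
    calc (2 + B * K) * e * t * m ≤ (2 + B * K) * e * t * (A * (c₁ * t ^ d)) := by gcongr
      _ = _ := by rw [div_pow]; field_simp
  exact le_of_mul_le_mul_right k10 (by positivity)

/-- The tent cut at height s·t is, up to that factor, an approximate indicator of the ball that
equals one on B(y,(1-s)t). Since it has height s·t, an error s²·t·μ(B) is a relative error s. -/
theorem FlatApprox.mul_pow_le_measure_ball {s : ℝ} (h : FlatApprox μ y ((3 / 2) * t) p J c ε)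
    (ht : 0 < t) (hc : 0 ≤ c) (hs : 0 < s) (hs' : s ≤ 1 / 4) (hD : ‖y - p‖ ≤ s * t)
    (hε : ε ≤ s ^ 2 * t * μ.real (ball y t)) :
    (1 - 2 * s) ^ d * (c * t ^ d) ≤ (1 + s) * μ.real (ball y t) := by
  set ψ : EuclideanSpace ℝ (Fin n) → ℝ := fun z => min (s * t) (tent y t z) with hψ
  have hψL : LipschitzWith 1 ψ := (lipschitzWith_tent y t).const_min _
  have hψ0 : ∀ z, 0 ≤ ψ z := fun z => le_min (by positivity) (tent_nonneg y t z)
  have hψs : Function.support ψ ⊆ ball y t := fun z hz => support_tent y t fun h0 => hz (by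
    simp only [hψ, h0]; exact min_eq_right (by positivity))
  have k1 := h ψ hψL (hψs.trans (ball_subset_ball (by linarith)))
  have k2 : ∫ z, ψ z ∂μ ≤ s * t * μ.real (ball y t) :=
    integral_le_mul_measureReal (integrable_of_support_subset_ball
      hψL.continuous (hψs.trans ball_subset_closedBall))
      measurableSet_ball measure_ball_lt_top.ne (fun z => min_le_left _ _) hψs
  have hpos : 0 < (1 - 2 * s) * t := by apply mul_pos <;> linarith
  have k3 : s * t * ((1 - 2 * s) * t) ^ d ≤ ∫ v, ψ (p + J v) ∂(hausdorffN d d) := by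
    rw [← hausdorffN_real_ball (0 : EuclideanSpace ℝ (Fin d)) hpos]
    refine mul_measureReal_le_integral (integrable_comp_plane hψL.continuous hψs p J)
      (fun v => hψ0 _) measurableSet_ball measure_ball_lt_top.ne fun v hv => ?_
    refine le_min le_rfl ?_
    have h1 := le_tent y t (p + J v)
    have h2 := dist_le_norm_add (J := J) (y := y) (p := p) v
    rw [mem_ball, dist_zero_right] at hv
    linarith
  have k4 := mul_le_mul_of_nonneg_left k3 hc
  rw [mul_pow] at k4
  have k5 : s * t * ((1 - 2 * s) ^ d * (c * t ^ d)) ≤ s * t * ((1 + s) * μ.real (ball y t)) := by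
    nlinarith [(abs_le.1 k1).1]
  exact le_of_mul_le_mul_left k5 (by positivity)

/-- The companion test function is a truncated tent on radius (1+s)t, equal to s·t on the closed
ball; the approximation on radius 3t/2 leaves room for it. -/
theorem FlatApprox.measure_closedBall_le {s : ℝ} (h : FlatApprox μ y ((3 / 2) * t) p J c ε)
    (ht : 0 < t) (hc : 0 ≤ c) (hs : 0 < s) (hs' : s ≤ 1 / 4) (hp : coord J (y - p) = 0)
    (hε : ε ≤ s ^ 2 * t * μ.real (ball y t)) :
    (1 - s) * μ.real (closedBall y t) ≤ (1 + s) ^ d * (c * t ^ d) := by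
  set ψ : EuclideanSpace ℝ (Fin n) → ℝ := fun z => min (s * t) (tent y ((1 + s) * t) z) with hψ
  have hpos : 0 < (1 + s) * t := by positivity
  have hψL : LipschitzWith 1 ψ := (lipschitzWith_tent y _).const_min _
  have hψ0 : ∀ z, 0 ≤ ψ z := fun z => le_min (by positivity) (tent_nonneg y _ z)
  have hψs : Function.support ψ ⊆ ball y ((1 + s) * t) := fun z hz =>
    support_tent y _ fun h0 => hz (by
      simp only [hψ, h0]; exact min_eq_right (by positivity))
  have k1 := h ψ hψL (hψs.trans (ball_subset_ball (by nlinarith)))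
  have k2 : s * t * μ.real (closedBall y t) ≤ ∫ z, ψ z ∂μ :=
    mul_measureReal_le_integral (integrable_of_support_subset_ball
      hψL.continuous (hψs.trans ball_subset_closedBall)) hψ0
      measurableSet_closedBall measure_closedBall_lt_top.ne (fun z hz => le_min le_rfl (by
        have := le_tent y ((1 + s) * t) z
        have := mem_closedBall.1 hz
        linarith))
  have k3 : ∫ v, ψ (p + J v) ∂(hausdorffN d d) ≤ s * t * ((1 + s) * t) ^ d := by
    rw [← hausdorffN_real_ball (0 : EuclideanSpace ℝ (Fin d)) hpos]
    refine integral_le_mul_measureReal (integrable_comp_plane hψL.continuous hψs p J)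
      measurableSet_ball measure_ball_lt_top.ne (fun v => min_le_left _ _) fun v hv => ?_
    have : dist (p + J v) y < (1 + s) * t := hψs hv
    simpa using (norm_le_dist_of_coord_eq_zero hp v).trans_lt this
  have k4 := mul_le_mul_of_nonneg_left k3 hc
  rw [mul_pow] at k4
  have k6 : μ.real (ball y t) ≤ μ.real (closedBall y t) :=
    measureReal_mono ball_subset_closedBall measure_closedBall_lt_top.ne
  have k7 : ε ≤ s ^ 2 * t * μ.real (closedBall y t) := hε.trans (by gcongr)
  have k5 : s * t * ((1 - s) * μ.real (closedBall y t)) ≤ s * t * ((1 + s) ^ d * (c * t ^ d)) := by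
    nlinarith [(abs_le.1 k1).2]
  exact le_of_mul_le_mul_left k5 (by positivity)

end Approx

/-! ### Doubling bounds. -/

section Doubling

variable {n : ℕ} {C : ℝ} {μ : Measure (EuclideanSpace ℝ (Fin n))} [IsLocallyFiniteMeasure μ]
  {y : EuclideanSpace ℝ (Fin n)} {t : ℝ}

omit [IsLocallyFiniteMeasure μ] in
theorem measure_ball_pos_of_mem_support (hy : y ∈ μ.support) (ht : 0 < t) : 0 < μ (ball y t) :=
  (Measure.mem_support_iff_forall y).1 hy _ (ball_mem_nhds y ht)

theorem measureReal_ball_pos (hy : y ∈ μ.support) (ht : 0 < t) : 0 < μ.real (ball y t) :=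
  ENNReal.toReal_pos (measure_ball_pos_of_mem_support hy ht).ne' measure_ball_lt_top.ne

theorem measureReal_ball_mono {z : EuclideanSpace ℝ (Fin n)} {s : ℝ} (h : ball y t ⊆ ball z s) :
    μ.real (ball y t) ≤ μ.real (ball z s) :=
  measureReal_mono h measure_ball_lt_top.ne

theorem IsDoublingWith.measureReal_le (h : IsDoublingWith C μ) (hC : 0 ≤ C) (hy : y ∈ μ.support)
    (ht : 0 < t) : μ.real (ball y (2 * t)) ≤ C * μ.real (ball y t) := by
  have h1 := ENNReal.toReal_mono
    (ENNReal.mul_ne_top ENNReal.ofReal_ne_top measure_ball_lt_top.ne) (h y hy t ht)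
  rwa [ENNReal.toReal_mul, ENNReal.toReal_ofReal hC] at h1

theorem IsDoublingWith.measureReal_pow_le (h : IsDoublingWith C μ) (hC : 0 ≤ C)
    (hy : y ∈ μ.support) (ht : 0 < t) (j : ℕ) :
    μ.real (ball y (2 ^ j * t)) ≤ C ^ j * μ.real (ball y t) := by
  induction j with
  | zero => simp
  | succ j ih =>
    calc μ.real (ball y (2 ^ (j + 1) * t)) = μ.real (ball y (2 * (2 ^ j * t))) := by
          rw [pow_succ']; ring_nf
      _ ≤ C * μ.real (ball y (2 ^ j * t)) := h.measureReal_le hC hy (by positivity)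
      _ ≤ C * (C ^ j * μ.real (ball y t)) := by gcongr
      _ = _ := by ring

end Doubling

/-! ### Stability of planes and densities across scales. -/

/-- In a doubling measure, two good flat approximations in the same ball have close directions and
densities. -/
theorem exists_compare_const (d : ℕ) {C : ℝ} (hC : 1 ≤ C) :
    ∃ e₀ > 0, ∃ K > 0, ∀ (n : ℕ) (μ : Measure (EuclideanSpace ℝ (Fin n)))
      [IsLocallyFiniteMeasure μ], IsDoublingWith C μ →
      ∀ y ∈ μ.support, ∀ (t : ℝ) (p₁ p₂ : EuclideanSpace ℝ (Fin n))
        (J₁ J₂ : EuclideanSpace ℝ (Fin d) →ₗᵢ[ℝ] EuclideanSpace ℝ (Fin n)) (c₁ c₂ e : ℝ),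
        0 < t → 0 ≤ c₁ → 0 ≤ c₂ → 0 ≤ e → e ≤ e₀ →
        FlatApprox μ y t p₁ J₁ c₁ (e * t * μ.real (ball y t)) →
        FlatApprox μ y t p₂ J₂ c₂ (e * t * μ.real (ball y t)) →
        (∀ v, ‖normalPart J₁ (J₂ v)‖ ≤ K * e * ‖v‖) ∧ |c₁ - c₂| ≤ K * e * c₁ := by
  have hC0 : 0 < C := by linarith
  -- C³ passes from radius t to t/8, so that B(y,t/8) has enough mass to bring both planes within
  -- t/4 of y. The second constant is the sum of the direction constant and the density constant,
  -- with A = 4C and B = 4·4ᵈ.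
  refine ⟨1 / (128 * 4 ^ d * C ^ 3), by positivity,
    32 * 4 ^ d * (4 * C) + 2 * 4 ^ d * (2 + 4 * 4 ^ d * (4 * 4 ^ d * (4 * C))) * (4 * C),
    by positivity, fun n μ _ hμ y hy t p₁ p₂ J₁ J₂ c₁ c₂ e ht hc₁ hc₂ he he₀ h₁ h₂ => ?_⟩
  set m := μ.real (ball y t) with hm
  have hm0 : 0 < m := measureReal_ball_pos hy ht
  rw [le_div_iff₀ (by positivity)] at he₀
  have h4 : (1 : ℝ) ≤ 4 ^ d := one_le_pow₀ (by norm_num)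
  have hC3 : C ≤ C ^ 3 := le_self_pow₀ hC (by norm_num)
  have he1 : e * (128 * C ^ 3) ≤ 1 := by
    refine le_trans ?_ he₀
    gcongr
    nlinarith
  have he2 : e * (128 * 4 ^ d * C) ≤ 1 := by
    refine le_trans ?_ he₀
    gcongr
  have he3 : e * (128 * C) ≤ 1 := by
    refine le_trans ?_ he1
    gcongr
  have he4 : e * 128 ≤ 1 := by
    refine le_trans ?_ he3
    gcongr
    linarith
  have hd8 : m ≤ C ^ 3 * μ.real (ball y (t / 8)) := by
    have := hμ.measureReal_pow_le hC0.le hy (t := t / 8) (by positivity) 3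
    rwa [show (2 : ℝ) ^ 3 * (t / 8) = t by ring] at this
  have hd2 : m ≤ C * μ.real (ball y (t / 2)) := by
    have := hμ.measureReal_le hC0.le hy (t := t / 2) (by positivity)
    rwa [show (2 : ℝ) * (t / 2) = t by ring] at this
  have hm8 : 0 < μ.real (ball y (t / 8)) := measureReal_ball_pos hy (by positivity)
  have hB : e * t * m < t / 8 * μ.real (ball y (t / 8)) := by
    have : e * m ≤ e * (C ^ 3 * μ.real (ball y (t / 8))) := by gcongr
    have : e * m < 1 / 8 * μ.real (ball y (t / 8)) := by nlinarith
    nlinarith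
  have hem : e * t * m ≤ t * m := by
    have : 0 ≤ t * m := by positivity
    nlinarith
  have hCem : 4 * C * (e * t * m) ≤ t * m := by
    have : 0 ≤ t * m := by positivity
    nlinarith
  have hsmall : 4 * 4 ^ d * (4 * C) * e < 1 / 4 := by nlinarith
  obtain ⟨g₁, q₁, D₁⟩ := h₁.recenter y
  obtain ⟨g₂, q₂, D₂⟩ := h₂.recenter y
  have hsub : ball y (2 * (t / 8)) ⊆ ball y t := ball_subset_ball (by linarith)
  have D₁' := D₁.trans_le (h₁.norm_normalPart_lt hsub hB).le
  have D₂' := D₂.trans_le (h₂.norm_normalPart_lt hsub hB).le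
  rw [show 2 * (t / 8) = t / 4 by ring] at D₁' D₂'
  have a₁ := g₁.le_coeff ht hc₁ q₁ hC0 hd2 hCem
  have a₂ := g₂.le_coeff ht hc₂ q₂ hC0 hd2 hCem
  have b₂ := g₂.coeff_le ht hc₂ D₂' hem
  constructor
  · intro v
    refine (g₁.norm_normalPart_map_le g₂ ht hc₂ D₂' (by positivity) rfl hm0 a₂ hsmall v).trans ?_
    gcongr
    exact le_add_of_nonneg_right (by positivity)
  · refine (g₁.abs_coeff_sub_le g₂ ht hc₁ hc₂ q₁ q₂ D₁' D₂' (by positivity) (by positivity) he rfl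
      hm0 a₁ a₂ b₂ hsmall).trans ?_
    gcongr
    exact le_add_of_nonneg_left (by positivity)

/-- Points of the support are close to the approximating plane. -/
theorem exists_near_plane_const {C δ : ℝ} (hC : 1 ≤ C) (hδ : 0 < δ) (hδ' : δ ≤ 1 / 2) :
    ∃ e₀ > 0, ∀ (d n : ℕ) (μ : Measure (EuclideanSpace ℝ (Fin n)))
      [IsLocallyFiniteMeasure μ], IsDoublingWith C μ →
      ∀ (y z p : EuclideanSpace ℝ (Fin n)) (R : ℝ)
        (J : EuclideanSpace ℝ (Fin d) →ₗᵢ[ℝ] EuclideanSpace ℝ (Fin n)) (c e : ℝ),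
        z ∈ μ.support → 0 < R → dist z y ≤ R → e ≤ e₀ →
        FlatApprox μ y (3 / 2 * R) p J c (e * R * μ.real (ball y (R / 2))) →
        ‖normalPart J (z - p)‖ ≤ δ * R := by
  have hC0 : 0 < C := by linarith
  -- After `j` doublings the ball around `z` of radius δR/2 has radius above 2R and contains
  -- B(y,R/2).
  obtain ⟨j, hj⟩ := pow_unbounded_of_one_lt (4 / δ) (one_lt_two (α := ℝ))
  refine ⟨δ / (4 * C ^ j), by positivity,
    fun d n μ _ hμ y z p R J c e hz hR hzy he h => ?_⟩
  have hzpos : 0 < μ.real (ball z (δ * R / 2)) := measureReal_ball_pos hz (by positivity)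
  have h1 : μ.real (ball y (R / 2)) ≤ C ^ j * μ.real (ball z (δ * R / 2)) := by
    refine (measureReal_ball_mono ?_).trans
      (hμ.measureReal_pow_le hC0.le hz (t := δ * R / 2) (by positivity) j)
    refine ball_subset_ball' ?_
    rw [dist_comm]
    rw [div_lt_iff₀ hδ] at hj
    nlinarith
  have h2 : e * R * μ.real (ball y (R / 2)) < δ * R / 2 * μ.real (ball z (δ * R / 2)) := by
    calc e * R * μ.real (ball y (R / 2))
        ≤ δ / (4 * C ^ j) * R * (C ^ j * μ.real (ball z (δ * R / 2))) := by gcongr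
      _ = δ * R / 4 * μ.real (ball z (δ * R / 2)) := by field_simp
      _ < _ := by gcongr; norm_num
  have h3 := h.norm_normalPart_lt (z := z) (δ := δ * R / 2) (ball_subset_ball' (by nlinarith)) h2
  linarith

/-- Flat approximations of `μ` around `y` at all scales `r / 2ᵏ`, with summable errors. -/
def IsGoodPoint (d : ℕ) {n : ℕ} (μ : Measure (EuclideanSpace ℝ (Fin n))) (r η : ℝ)
    (y : EuclideanSpace ℝ (Fin n)) : Prop :=
  ∃ (p : ℕ → EuclideanSpace ℝ (Fin n))
    (J : ℕ → EuclideanSpace ℝ (Fin d) →ₗᵢ[ℝ] EuclideanSpace ℝ (Fin n)) (c e : ℕ → ℝ),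
    (∀ k, 0 ≤ c k) ∧ (∀ k, 0 ≤ e k) ∧ (∀ N, ∑ k ∈ Finset.range N, e k ≤ η) ∧
    ∀ k, FlatApprox μ y (3 / 2 * (r / 2 ^ k)) (p k) (J k) (c k)
      (e k * (r / 2 ^ k) * μ.real (ball y (r / 2 ^ k / 2)))

/-- Tilts add rather than compound, which is what permits infinitely many scales with a summable
error. -/
theorem norm_normalPart_trans {d n : ℕ}
    {J₀ J₁ : EuclideanSpace ℝ (Fin d) →ₗᵢ[ℝ] EuclideanSpace ℝ (Fin n)} {a b : ℝ}
    (h₀₁ : ∀ v, ‖normalPart J₀ (J₁ v)‖ ≤ a * ‖v‖) (ha : 0 ≤ a) {z : EuclideanSpace ℝ (Fin n)}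
    (h₁₂ : ‖normalPart J₁ z‖ ≤ b) : ‖normalPart J₀ z‖ ≤ a * ‖z‖ + b := by
  have e : z = J₁ (coord J₁ z) + normalPart J₁ z := by simp [normalPart_apply]
  calc ‖normalPart J₀ z‖ = ‖normalPart J₀ (J₁ (coord J₁ z)) + normalPart J₀ (normalPart J₁ z)‖ := by
        rw [← map_add, ← e]
    _ ≤ a * ‖coord J₁ z‖ + ‖normalPart J₁ z‖ :=
        (norm_add_le _ _).trans (add_le_add (h₀₁ _) (norm_normalPart_le _ _))
    _ ≤ _ := by
        gcongr
        exact norm_coord_le _ _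

/-- Around a good point, directions and densities at all scales stay close to those of a flat
approximation in a large ball. -/
theorem exists_chain_const (d : ℕ) {C : ℝ} (hC : 1 ≤ C) :
    ∃ η₀ > 0, ∃ K > 0, ∀ (n : ℕ) (μ : Measure (EuclideanSpace ℝ (Fin n)))
      [IsLocallyFiniteMeasure μ], IsDoublingWith C μ →
      ∀ (x y p₀ : EuclideanSpace ℝ (Fin n)) (r η c₀ : ℝ)
        (J₀ : EuclideanSpace ℝ (Fin d) →ₗᵢ[ℝ] EuclideanSpace ℝ (Fin n))
        (p : ℕ → EuclideanSpace ℝ (Fin n))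
        (J : ℕ → EuclideanSpace ℝ (Fin d) →ₗᵢ[ℝ] EuclideanSpace ℝ (Fin n)) (c e : ℕ → ℝ),
        0 < r → y ∈ μ.support → y ∈ ball x r → η ≤ η₀ → 0 ≤ c₀ →
        FlatApprox μ x (3 / 2 * r) p₀ J₀ c₀ (η * r * μ.real (ball x (r / 2))) →
        (∀ k, 0 ≤ c k) → (∀ k, 0 ≤ e k) → (∀ N, ∑ k ∈ Finset.range N, e k ≤ η) →
        (∀ k, FlatApprox μ y (3 / 2 * (r / 2 ^ k)) (p k) (J k) (c k)
          (e k * (r / 2 ^ k) * μ.real (ball y (r / 2 ^ k / 2)))) →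
        ∀ k, (∀ v, ‖normalPart J₀ (J k v)‖ ≤ K * η * ‖v‖) ∧ |c₀ - c k| ≤ K * η * c₀ := by
  have hC0 : 0 < C := by linarith
  obtain ⟨e₀, he₀, K, hK, hcomp⟩ := exists_compare_const d hC
  -- The term 4C² pays for the passage from the ball around `x` to the one around `y`; the term 4
  -- bounds the sum of 2(eⱼ + eⱼ₊₁).
  set L := 4 * C ^ 2 + 4 with hL
  have hL0 : 0 < L := by positivity
  have hL4 : 4 ≤ L := by rw [hL]; nlinarith [sq_nonneg C]
  refine ⟨min (e₀ / L) (1 / (2 * K * L)), by positivity, 2 * K * L, by positivity, ?_⟩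
  intro n μ _ hμ x y p₀ r η c₀ J₀ p J c e hr hy hyx hη hc₀ h₀ hc he hsum h
  have hη0 : 0 ≤ η := by simpa using hsum 0
  have hηe : L * η ≤ e₀ := by
    have := hη.trans (min_le_left _ _)
    rw [le_div_iff₀ hL0] at this
    linarith
  have hηK : 2 * K * L * η ≤ 1 := by
    have := hη.trans (min_le_right _ _)
    rw [le_div_iff₀ (by positivity)] at this
    linarith
  have hek : ∀ k, e k ≤ η := fun k =>
    (Finset.single_le_sum (fun i _ => he i) (Finset.self_mem_range_succ k)).trans (hsum (k + 1))
  have hC2 : 1 ≤ C ^ 2 := one_le_pow₀ hC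
  have htop := hcomp n μ hμ y hy (r / 2) p₀ (p 0) J₀ (J 0) c₀ (c 0) (4 * C ^ 2 * η) (by positivity)
    hc₀ (hc 0) (by positivity) (by linarith) (h₀.mono_ball (ball_subset_ball' (by
      have := mem_ball.1 hyx
      linarith)) (by
      have h1 : μ.real (ball x (r / 2)) ≤ C ^ 2 * μ.real (ball y (r / 2)) := by
        refine (measureReal_ball_mono (ball_subset_ball' ?_)).trans
          (hμ.measureReal_pow_le hC0.le hy (by positivity) 2)
        have := mem_ball'.1 hyx
        linarith
      calc η * r * μ.real (ball x (r / 2)) ≤ η * r * (C ^ 2 * μ.real (ball y (r / 2))) := by gcongr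
        _ ≤ 2 * (η * r * (C ^ 2 * μ.real (ball y (r / 2)))) := by
            have : 0 ≤ η * r * (C ^ 2 * μ.real (ball y (r / 2))) := by positivity
            linarith
        _ = _ := by ring)) ((h 0).mono_ball (ball_subset_ball (by simp; linarith)) (by
      simp only [pow_zero, div_one]
      calc e 0 * r * μ.real (ball y (r / 2)) ≤ (2 * C ^ 2 * η) * r * μ.real (ball y (r / 2)) := by
            gcongr
            nlinarith [hek 0]
        _ = _ := by ring))
  -- Consecutive scales are compared in B(y,R/2), which lies in both balls, of radii 3R/2 and 3R/4.
  have hstep : ∀ k, (∀ v, ‖normalPart (J k) (J (k + 1) v)‖ ≤ K * (2 * (e k + e (k + 1))) * ‖v‖) ∧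
      |c k - c (k + 1)| ≤ K * (2 * (e k + e (k + 1))) * c k := by
    intro k
    have hR : 0 < r / 2 ^ k := by positivity
    have hR' : r / 2 ^ (k + 1) = r / 2 ^ k / 2 := by rw [pow_succ]; field_simp
    set R := r / 2 ^ k with hRdef
    refine hcomp n μ hμ y hy (R / 2) (p k) (p (k + 1)) (J k) (J (k + 1)) (c k) (c (k + 1)) _
      (by positivity) (hc k) (hc (k + 1)) (by linarith [he k, he (k + 1)]) (by
        nlinarith [hek k, hek (k + 1)]) ((h k).mono_ball (ball_subset_ball (by linarith)) ?_)
      ((h (k + 1)).mono_ball (ball_subset_ball (by rw [hR']; linarith)) ?_)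
    · calc e k * R * μ.real (ball y (R / 2))
          ≤ (e k + e (k + 1)) * R * μ.real (ball y (R / 2)) := by
            gcongr
            linarith [he (k + 1)]
        _ = _ := by ring
    · rw [hR']
      have := he k
      have := he (k + 1)
      calc e (k + 1) * (R / 2) * μ.real (ball y (R / 2 / 2))
          ≤ (2 * (e k + e (k + 1))) * (R / 2) * μ.real (ball y (R / 2)) := by
            gcongr
            · linarith
            · exact measure_ball_lt_top.ne
            · linarith
        _ = _ := by ring
  set S : ℕ → ℝ := fun k => 4 * C ^ 2 * η + ∑ j ∈ Finset.range k, 2 * (e j + e (j + 1)) with hS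
  have hS0 : ∀ k, 0 ≤ S k := fun k => add_nonneg (by positivity)
    (Finset.sum_nonneg fun j _ => by linarith [he j, he (j + 1)])
  have hSle : ∀ k, S k ≤ L * η := by
    intro k
    have h1 := hsum (k + 1)
    have h2 := hsum (k + 1)
    rw [Finset.sum_range_succ'] at h2
    rw [Finset.sum_range_succ] at h1
    simp only [hS, ← Finset.mul_sum, Finset.sum_add_distrib]
    rw [hL]
    linarith [he k, he 0]
  have hSs : ∀ k, S (k + 1) = S k + 2 * (e k + e (k + 1)) := fun k => by
    simp only [hS, Finset.sum_range_succ]; ring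
  have hmain : ∀ k, (∀ v, ‖normalPart J₀ (J k v)‖ ≤ K * S k * ‖v‖) ∧
      |c₀ - c k| ≤ 2 * K * S k * c₀ := by
    intro k
    induction k with
    | zero =>
      have e1 : S 0 = 4 * C ^ 2 * η := by simp [hS]
      rw [e1]
      refine ⟨htop.1, htop.2.trans ?_⟩
      have : 0 ≤ K * (4 * C ^ 2 * η) * c₀ := by positivity
      linarith
    | succ k ih =>
      have he' : 0 ≤ 2 * (e k + e (k + 1)) := by linarith [he k, he (k + 1)]
      constructor
      · intro v
        have := norm_normalPart_trans ih.1 (mul_nonneg hK.le (hS0 k)) ((hstep k).1 v)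
        rw [(J (k + 1)).norm_map] at this
        rw [hSs]
        linarith
      · have hck : c k ≤ 2 * c₀ := by
          have h1 := (abs_le.1 ih.2).1
          have h2 : 2 * K * S k * c₀ ≤ 1 * c₀ := by
            gcongr
            exact (mul_le_mul_of_nonneg_left (hSle k) (by positivity)).trans (by linarith)
          linarith
        calc |c₀ - c (k + 1)| = |(c₀ - c k) + (c k - c (k + 1))| := by ring_nf
          _ ≤ 2 * K * S k * c₀ + K * (2 * (e k + e (k + 1))) * c k :=
              (abs_add_le _ _).trans (add_le_add ih.2 (hstep k).2)
          _ ≤ 2 * K * S k * c₀ + K * (2 * (e k + e (k + 1))) * (2 * c₀) := by gcongr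
          _ = _ := by rw [hSs]; ring
  intro k
  have hKS : K * S k ≤ K * (L * η) := mul_le_mul_of_nonneg_left (hSle k) hK.le
  have hKL : 0 ≤ K * (L * η) := by positivity
  constructor
  · intro v
    refine ((hmain k).1 v).trans (mul_le_mul_of_nonneg_right ?_ (norm_nonneg v))
    linarith
  · refine (hmain k).2.trans (mul_le_mul_of_nonneg_right ?_ hc₀)
    linarith

/-- Geometry and density at the good points, relative to a flat approximation in a large ball. -/
theorem exists_good_point_const (d : ℕ) {C s : ℝ} (hC : 1 ≤ C) (hs : 0 < s) (hs' : s ≤ 1 / 4) :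
    ∃ η > 0, ∀ (n : ℕ) (μ : Measure (EuclideanSpace ℝ (Fin n)))
      [IsLocallyFiniteMeasure μ], IsDoublingWith C μ →
      ∀ (x p₀ : EuclideanSpace ℝ (Fin n)) (r c₀ : ℝ)
        (J₀ : EuclideanSpace ℝ (Fin d) →ₗᵢ[ℝ] EuclideanSpace ℝ (Fin n)),
        0 < r → x ∈ μ.support → 0 ≤ c₀ →
        FlatApprox μ x (3 / 2 * r) p₀ J₀ c₀ (η * r * μ.real (ball x (r / 2))) →
        ((1 - 2 * s) ^ d * (c₀ * r ^ d) ≤ (1 + s) * μ.real (ball x r) ∧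
          (1 - s) * μ.real (ball x r) ≤ (1 + s) ^ d * (c₀ * r ^ d)) ∧
        ∀ y ∈ μ.support, y ∈ ball x r → IsGoodPoint d μ r η y →
          (∀ z ∈ μ.support, z ∈ ball x r → ‖normalPart J₀ (y - z)‖ ≤ s * ‖y - z‖) ∧
          ∀ k : ℕ, (1 - 2 * s) ^ d * ((1 - s) * c₀ * (r / 2 ^ k) ^ d)
              ≤ (1 + s) * μ.real (ball y (r / 2 ^ k)) ∧
            (1 - s) * μ.real (closedBall y (r / 2 ^ k))
              ≤ (1 + s) ^ d * ((1 + s) * c₀ * (r / 2 ^ k) ^ d) := by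
  -- If R/2 < ‖y - z‖ ≤ R, two points within sR/8 of a plane differ by a normal part of at most
  -- (s/2)‖y - z‖. The remaining s/2 is left for the tilt K·η of that plane against `J₀`.
  obtain ⟨e₁, he₁, hnear⟩ := exists_near_plane_const hC (δ := s / 8) (by positivity) (by linarith)
  obtain ⟨η₀, hη₀, K, hK, hchain⟩ := exists_chain_const d hC
  set η := min (min η₀ e₁) (min (s ^ 2) (s / (2 * K))) with hηdef
  have hη : 0 < η := by positivity
  have hη1 : η ≤ η₀ := (min_le_left _ _).trans (min_le_left _ _)
  have hη2 : η ≤ e₁ := (min_le_left _ _).trans (min_le_right _ _)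
  have hη3 : η ≤ s ^ 2 := (min_le_right _ _).trans (min_le_left _ _)
  have hη4 : K * η ≤ s / 2 := by
    have : η ≤ s / (2 * K) := (min_le_right _ _).trans (min_le_right _ _)
    rw [le_div_iff₀ (by positivity)] at this
    linarith
  refine ⟨η, hη, fun n μ _ hμ x p₀ r c₀ J₀ hr hx hc₀ h₀ => ?_⟩
  have hdens : ∀ (y : EuclideanSpace ℝ (Fin n)) (R e c : ℝ) (p : EuclideanSpace ℝ (Fin n))
      (J : EuclideanSpace ℝ (Fin d) →ₗᵢ[ℝ] EuclideanSpace ℝ (Fin n)), y ∈ μ.support → 0 < R →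
      e ≤ η → 0 ≤ c → FlatApprox μ y (3 / 2 * R) p J c (e * R * μ.real (ball y (R / 2))) →
      (1 - 2 * s) ^ d * (c * R ^ d) ≤ (1 + s) * μ.real (ball y R) ∧
        (1 - s) * μ.real (closedBall y R) ≤ (1 + s) ^ d * (c * R ^ d) := by
    intro y R e c p J hy hR he hc h
    have hD := hnear d n μ hμ y y p R J c e hy hR (by simpa using hR.le) (he.trans hη2) h
    obtain ⟨g, q, D⟩ := h.recenter y
    have hε : e * R * μ.real (ball y (R / 2)) ≤ s ^ 2 * R * μ.real (ball y R) := by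
      gcongr
      · exact he.trans hη3
      · exact measure_ball_lt_top.ne
      · linarith
    refine ⟨g.mul_pow_le_measure_ball hR hc hs hs' (D.trans_le (hD.trans ?_)) hε,
      g.measure_closedBall_le hR hc hs hs' q hε⟩
    gcongr
    linarith
  refine ⟨?_, ?_⟩
  · obtain ⟨h1, h2⟩ := hdens x r η c₀ p₀ J₀ hx hr le_rfl hc₀ h₀
    refine ⟨h1, le_trans ?_ h2⟩
    have : 0 ≤ 1 - s := by linarith
    gcongr
    · exact measure_closedBall_lt_top.ne
    · exact ball_subset_closedBall
  rintro y hy hyx ⟨p, J, c, e, hc, he, hsum, h⟩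
  have hch := hchain n μ hμ x y p₀ r η c₀ J₀ p J c e hr hy hyx hη1 hc₀ h₀ hc he hsum h
  have hek : ∀ k, e k ≤ η := fun k =>
    (Finset.single_le_sum (fun i _ => he i) (Finset.self_mem_range_succ k)).trans (hsum (k + 1))
  constructor
  · intro z hz hzx
    rcases eq_or_ne y z with rfl | hyz
    · simp
    have hpos : 0 < ‖y - z‖ := norm_pos_iff.2 (sub_ne_zero.2 hyz)
    -- The approximations around `y` reach only distances up to r; for farther points the plane of
    -- the ball around `x` is used directly.
    by_cases hlarge : r ≤ ‖y - z‖
    · have h1 := hnear d n μ hμ x y p₀ r J₀ c₀ η hy hr (mem_ball.1 hyx).le hη2 h₀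
      have h2 := hnear d n μ hμ x z p₀ r J₀ c₀ η hz hr (mem_ball.1 hzx).le hη2 h₀
      rw [← sub_sub_sub_cancel_right y z p₀, map_sub]
      refine (norm_sub_le _ _).trans ?_
      rw [sub_sub_sub_cancel_right]
      nlinarith
    · push Not at hlarge
      obtain ⟨k, hk1, hk2⟩ : ∃ k : ℕ, r / 2 ^ (k + 1) < ‖y - z‖ ∧ ‖y - z‖ ≤ r / 2 ^ k := by
        obtain ⟨k, hk1, hk2⟩ := exists_nat_pow_near (x := r / ‖y - z‖) (y := (2 : ℝ))
          ((one_le_div hpos).2 hlarge.le) one_lt_two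
        refine ⟨k, ?_, ?_⟩
        · rw [div_lt_iff₀ hpos] at hk2
          rw [div_lt_iff₀ (by positivity)]; linarith
        · rw [le_div_iff₀ hpos] at hk1
          rw [le_div_iff₀ (by positivity)]; linarith
      have hR : 0 < r / 2 ^ k := by positivity
      have hR2 : r / 2 ^ (k + 1) = r / 2 ^ k / 2 := by rw [pow_succ]; field_simp
      have h1 := hnear d n μ hμ y y (p k) _ (J k) (c k) (e k) hy hR (by simpa using hR.le)
        ((hek k).trans hη2) (h k)
      have h2 := hnear d n μ hμ y z (p k) _ (J k) (c k) (e k) hz hR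
        (by rwa [dist_comm, dist_eq_norm]) ((hek k).trans hη2) (h k)
      have h3 : ‖normalPart (J k) (y - z)‖ ≤ s / 2 * ‖y - z‖ := by
        rw [← sub_sub_sub_cancel_right y z (p k), map_sub]
        refine (norm_sub_le _ _).trans ?_
        rw [sub_sub_sub_cancel_right]
        rw [hR2] at hk1
        nlinarith
      have h4 := norm_normalPart_trans (hch k).1 (by positivity) h3
      nlinarith
  · intro k
    obtain ⟨h1, h2⟩ := hdens y (r / 2 ^ k) (e k) (c k) (p k) (J k) hy (by positivity) (hek k)
      (hc k) (h k)
    have h3 : |c₀ - c k| ≤ s * c₀ := (hch k).2.trans (by gcongr; linarith)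
    have h4 := abs_le.1 h3
    have h5 : 0 ≤ 1 - 2 * s := by linarith
    refine ⟨le_trans ?_ h1, h2.trans ?_⟩
    · gcongr
      linarith
    · gcongr
      linarith

/-! ### From the Carleson integral to good points. -/

/-- Strict sublevel sets are unions of open balls, whatever `a` is. Replacing α by such an infimum
over nearby points avoids any question about its measurability in the point. -/
theorem measurable_biInf_ball {X : Type*} [PseudoMetricSpace X] [MeasurableSpace X]
    [OpensMeasurableSpace X] (S : Set X) (a : X → ℝ≥0∞) (ρ : ℝ) :
    Measurable fun y => ⨅ z ∈ S ∩ ball y ρ, a z := by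
  refine measurable_of_Iio fun c => ?_
  have : (fun y => ⨅ z ∈ S ∩ ball y ρ, a z) ⁻¹' Iio c = ⋃ z ∈ {z ∈ S | a z < c}, ball z ρ := by
    ext y
    simp only [mem_preimage, mem_Iio, iInf_lt_iff, mem_iUnion, mem_inter_iff, mem_ofPred_eq,
      exists_prop]
    constructor
    · rintro ⟨z, ⟨hz, hzy⟩, ha⟩
      exact ⟨z, ⟨hz, ha⟩, mem_ball_comm.1 hzy⟩
    · rintro ⟨z, ⟨hz, ha⟩, hzy⟩
      exact ⟨z, ⟨hz, mem_ball_comm.1 hzy⟩, ha⟩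
  rw [this]
  exact (isOpen_biUnion fun _ _ => isOpen_ball).measurableSet

/-- A sum over dyadic scales is controlled by an integral against `dt / t`. -/
theorem tsum_div_le_lintegral_div {r : ℝ} (hr : 0 < r) {a : ℝ → ℝ≥0∞} {b : ℕ → ℝ≥0∞}
    (hab : ∀ k : ℕ, ∀ t ∈ Ico (9 / 10 * (r / 2 ^ k)) (r / 2 ^ k), b k ≤ a t) :
    (∑' k, b k) / 10 ≤ ∫⁻ t in Ioo 0 r, a t / ENNReal.ofReal t := by
  -- Each window has dt/t-mass at least 1/10, and the windows are disjoint. Only lower bounds by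
  -- constants are integrated, so no measurability of `a` enters.
  set I : ℕ → Set ℝ := fun k => Ico (9 / 10 * (r / 2 ^ k)) (r / 2 ^ k) with hI
  have hlt : ∀ {j k : ℕ}, j < k → r / 2 ^ k ≤ 9 / 10 * (r / 2 ^ j) := by
    intro j k hjk
    have h1 : r / 2 ^ k ≤ r / 2 ^ (j + 1) := by
      gcongr
      · norm_num
      · exact hjk
    have h2 : r / 2 ^ (j + 1) = 1 / 2 * (r / 2 ^ j) := by rw [pow_succ]; field_simp
    have h3 : 0 < r / 2 ^ j := by positivity
    linarith
  have hdisj : Pairwise (Function.onFun Disjoint I) := by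
    intro j k hjk
    refine Set.disjoint_left.2 fun t htj htk => ?_
    rcases lt_or_gt_of_ne hjk with h | h
    · linarith [htk.2, hlt h, htj.1]
    · linarith [htj.2, hlt h, htk.1]
  have hsub : ⋃ k, I k ⊆ Ioo 0 r := by
    refine iUnion_subset fun k t ht => ⟨?_, ?_⟩
    · have : 0 < r / 2 ^ k := by positivity
      linarith [ht.1]
    · exact ht.2.trans_le (div_le_self hr.le (one_le_pow₀ (by norm_num)))
  calc (∑' k, b k) / 10 = ∑' k, b k / 10 := by simp_rw [div_eq_mul_inv, ENNReal.tsum_mul_right]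
    _ ≤ ∑' k, ∫⁻ t in I k, a t / ENNReal.ofReal t := by
        refine ENNReal.tsum_le_tsum fun k => ?_
        have hT : 0 < r / 2 ^ k := by positivity
        calc b k / 10 = ∫⁻ _ in I k, b k / ENNReal.ofReal (r / 2 ^ k) := by
              have h1 : ∀ T : ℝ, 0 < T →
                  (ENNReal.ofReal T)⁻¹ * ENNReal.ofReal (T / 10) = 10⁻¹ := fun T hT => by
                rw [ENNReal.ofReal_div_of_pos (show (0 : ℝ) < 10 by norm_num), div_eq_mul_inv,
                  ← mul_assoc, ENNReal.inv_mul_cancel (by simpa using hT) ENNReal.ofReal_ne_top,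
                  one_mul]
                simp
              rw [setLIntegral_const, hI, Real.volume_Ico,
                show r / 2 ^ k - 9 / 10 * (r / 2 ^ k) = r / 2 ^ k / 10 by ring,
                div_eq_mul_inv, div_eq_mul_inv (b k), mul_assoc, h1 _ hT]
          _ ≤ _ := by
              refine setLIntegral_mono' measurableSet_Ico fun t ht => ?_
              gcongr
              · exact hab k t ht
              · exact ht.2.le
    _ = ∫⁻ t in ⋃ k, I k, a t / ENNReal.ofReal t :=
        (lintegral_iUnion (fun k => measurableSet_Ico) hdisj _).symm
    _ ≤ _ := lintegral_mono_set hsub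

/-- A small `α_d` at a nearby point and a comparable scale gives a flat approximation. -/
theorem exists_flatApprox_of_alphaNumber_lt {d n : ℕ} {C : ℝ} (hC : 1 ≤ C)
    {μ : Measure (EuclideanSpace ℝ (Fin n))} [IsLocallyFiniteMeasure μ] (hμ : IsDoublingWith C μ)
    {y z : EuclideanSpace ℝ (Fin n)} {t R b : ℝ} (hy : y ∈ μ.support) (hz : z ∈ μ.support)
    (hR : 0 < R) (ht : 9 / 5 * R ≤ t) (ht' : t < 2 * R) (hyz : dist y z ≤ R / 10) (hb : 0 ≤ b)
    (hα : alphaNumber d μ y t < ENNReal.ofReal b) :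
    ∃ (p : EuclideanSpace ℝ (Fin n))
      (J : EuclideanSpace ℝ (Fin d) →ₗᵢ[ℝ] EuclideanSpace ℝ (Fin n)) (c : ℝ), 0 ≤ c ∧
      FlatApprox μ z (3 / 2 * R) p J c (2 * C ^ 3 * b * R * μ.real (ball z (R / 2))) := by
  simp only [alphaNumber, iInf_lt_iff] at hα
  obtain ⟨V, hV, hW⟩ := hα
  have ht0 : 0 < t := by linarith
  obtain ⟨p, J, c, hc, h⟩ := FlatApprox.of_wassersteinBall_lt ht0 hb
    (measure_ball_pos_of_mem_support hy ht0) measure_ball_lt_top hV hW.le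
  -- Inclusion: 3R/2 + R/10 ≤ 9R/5 ≤ t. Conversely B(y,t) lies in B(z,4R), three doublings of
  -- B(z,R/2), whence C³.
  refine ⟨p, J, c, hc, h.mono_ball (ball_subset_ball' ?_) ?_⟩
  · rw [dist_comm]; linarith
  · have h1 : μ.real (ball y t) ≤ C ^ 3 * μ.real (ball z (R / 2)) :=
      (measureReal_ball_mono (ball_subset_ball' (by linarith))).trans
        (hμ.measureReal_pow_le (by linarith) hz (by positivity) 3)
    have hC0 : 0 ≤ C := by linarith
    calc b * t * μ.real (ball y t) ≤ b * (2 * R) * (C ^ 3 * μ.real (ball z (R / 2))) := by gcongr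
      _ = _ := by ring

/-- The Carleson condition, with a small constant, makes most points good. -/
theorem exists_carleson_const (d : ℕ) {C η γ : ℝ} (hC : 1 ≤ C) (hη : 0 < η) (hγ : 0 < γ) :
    ∃ C₁ > 0, ∀ (n : ℕ) (μ : Measure (EuclideanSpace ℝ (Fin n)))
      [IsLocallyFiniteMeasure μ], IsDoublingWith C μ →
      ∀ (x : EuclideanSpace ℝ (Fin n)) (r : ℝ), x ∈ μ.support → 0 < r →
        CarlesonCondition d C₁ μ x r →
        (∃ (p : EuclideanSpace ℝ (Fin n))
          (J : EuclideanSpace ℝ (Fin d) →ₗᵢ[ℝ] EuclideanSpace ℝ (Fin n)) (c : ℝ), 0 ≤ c ∧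
          FlatApprox μ x (3 / 2 * r) p J c (η * r * μ.real (ball x (r / 2)))) ∧
        ∃ G : Set (EuclideanSpace ℝ (Fin n)), MeasurableSet G ∧
          μ (ball x r \ G) ≤ ENNReal.ofReal γ * μ (ball x r) ∧
          ∀ y ∈ G, y ∈ μ.support → y ∈ ball x r → IsGoodPoint d μ r η y := by
  have hC0 : 0 < C := by linarith
  -- The errors will sum to at most 2C³·2η₁ = 2η/3: one η₁ from the α-numbers, one from the slack in
  -- choosing near-minimizers.
  set η₁ : ℝ := η / (6 * C ^ 3) with hη₁
  have hη₁0 : 0 < η₁ := by positivity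
  -- The second bound keeps the bad set from filling B(x,r/100), as 2⁷ ≥ 100.
  set κ : ℝ := min γ (1 / (2 * C ^ 7)) with hκ
  have hκ0 : 0 < κ := by positivity
  refine ⟨η₁ * κ / 10, by positivity, fun n μ _ hμ x r hx hr hcar => ?_⟩
  set S : Set (EuclideanSpace ℝ (Fin n)) := μ.support ∩ ball x (2 * r) with hS
  set R : ℕ → ℝ := fun k => r / 2 ^ k with hRdef
  have hR0 : ∀ k, 0 < R k := fun k => by positivity
  have hR2 : ∀ k, 2 * r / 2 ^ k = 2 * R k := fun k => by rw [hRdef, mul_div_assoc]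
  set I : ℕ → Set ℝ := fun k => Ico (9 / 10 * (2 * r / 2 ^ k)) (2 * r / 2 ^ k) with hI
  set β : ℕ → EuclideanSpace ℝ (Fin n) → ℝ≥0∞ := fun k y =>
    ⨅ z ∈ S ∩ ball y (R k / 50), ⨅ t ∈ I k, alphaNumber d μ z t with hβ
  have hβm : ∀ k, Measurable (β k) := fun k => measurable_biInf_ball S _ _
  set h : EuclideanSpace ℝ (Fin n) → ℝ≥0∞ := fun y => ∑' k, β k y with hh
  have hhm : Measurable h := Measurable.tsum hβm
  set G : Set (EuclideanSpace ℝ (Fin n)) := {y | h y < ENNReal.ofReal η₁} with hG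
  have hGm : MeasurableSet G := hhm measurableSet_Iio
  have hint : (∫⁻ y in ball x (2 * r), h y ∂μ) / 10
      ≤ ENNReal.ofReal (η₁ * κ / 10) * μ (ball x r) := by
    refine le_trans ?_ hcar
    rw [div_eq_mul_inv, ← lintegral_mul_const _ hhm]
    refine lintegral_mono_ae ?_
    filter_upwards [ae_restrict_mem measurableSet_ball,
      ae_restrict_of_ae (Measure.support_mem_ae (μ := μ))] with y hy hys
    refine tsum_div_le_lintegral_div (by positivity) fun k t ht => ?_
    exact (iInf₂_le y ⟨⟨hys, hy⟩, mem_ball_self (by have := hR0 k; positivity)⟩).trans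
      (iInf₂_le t ht)
  -- Chebyshev at level η₁; the 10 in the Carleson constant cancels the loss in passing to dyadic
  -- scales.
  have hbad : μ (ball x r \ G) ≤ ENNReal.ofReal κ * μ (ball x r) := by
    have h1 : ENNReal.ofReal η₁ * μ (ball x r \ G) ≤ ∫⁻ y in ball x (2 * r), h y ∂μ := by
      refine le_trans ?_ (mul_meas_ge_le_lintegral hhm (ENNReal.ofReal η₁))
      refine mul_le_mul_right ?_ _
      rw [Measure.restrict_apply (measurableSet_le measurable_const hhm)]
      refine measure_mono fun y hy => ⟨not_lt.1 (show ¬ h y < ENNReal.ofReal η₁ from hy.2), ball_subset_ball (by linarith) hy.1⟩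
    have h2 : ∫⁻ y in ball x (2 * r), h y ∂μ
        ≤ ENNReal.ofReal η₁ * (ENNReal.ofReal κ * μ (ball x r)) := by
      rw [ENNReal.div_le_iff (by norm_num) (by norm_num)] at hint
      refine hint.trans (le_of_eq ?_)
      rw [ENNReal.ofReal_div_of_pos (by norm_num), ENNReal.ofReal_mul hη₁0.le]
      rw [mul_right_comm, show ENNReal.ofReal (10 : ℝ) = 10 by simp,
        ENNReal.div_mul_cancel (by norm_num) (by norm_num), mul_assoc]
    exact (ENNReal.mul_le_mul_iff_right (by simpa using hη₁0) ENNReal.ofReal_ne_top).1 (h1.trans h2)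
  -- The infima need not be attained; the slacks η₁/2/2ᵏ sum to η₁.
  have hgood : ∀ y ∈ G, ∀ k, ∃ b : ℝ, b = (β k y).toReal + η₁ / 2 / 2 ^ k ∧ 0 ≤ b ∧
      ∃ z ∈ S ∩ ball y (R k / 50), ∃ t ∈ I k, alphaNumber d μ z t < ENNReal.ofReal b := by
    intro y hy k
    have hfin : β k y ≠ ∞ := ((ENNReal.le_tsum k).trans_lt (hy.trans ENNReal.ofReal_lt_top)).ne
    have hpos : 0 < η₁ / 2 / 2 ^ k := by positivity
    refine ⟨_, rfl, by positivity, ?_⟩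
    have h1 : β k y < ENNReal.ofReal ((β k y).toReal + η₁ / 2 / 2 ^ k) := by
      rw [ENNReal.ofReal_add ENNReal.toReal_nonneg hpos.le, ENNReal.ofReal_toReal hfin]
      exact ENNReal.lt_add_right hfin (by simpa using hpos)
    simpa only [hβ, iInf_lt_iff, exists_prop] using h1
  have hsum : ∀ y ∈ G, ∀ N, ∑ k ∈ Finset.range N, ((β k y).toReal + η₁ / 2 / 2 ^ k) ≤ 2 * η₁ := by
    intro y hy N
    have hfin : ∀ k, β k y ≠ ∞ := fun k =>
      ((ENNReal.le_tsum k).trans_lt (hy.trans ENNReal.ofReal_lt_top)).ne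
    rw [Finset.sum_add_distrib]
    have h1 : ∑ k ∈ Finset.range N, (β k y).toReal ≤ η₁ := by
      rw [← ENNReal.toReal_sum fun k _ => hfin k]
      refine ENNReal.toReal_le_of_le_ofReal hη₁0.le ?_
      exact (ENNReal.sum_le_tsum _).trans (le_of_lt hy)
    have h2 : ∑ k ∈ Finset.range N, η₁ / 2 / 2 ^ k ≤ η₁ := by
      have hs := hasSum_geometric_two' η₁
      exact sum_le_hasSum _ (fun k _ => by positivity) hs
    linarith
  have hη₁C : 2 * C ^ 3 * (2 * η₁) ≤ η := by
    rw [hη₁]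
    have : 2 * C ^ 3 * (2 * (η / (6 * C ^ 3))) = 2 / 3 * η := by field_simp; norm_num
    rw [this]; linarith
  refine ⟨?_, G, hGm, hbad.trans (by gcongr; exact min_le_left _ _), ?_⟩
  · obtain ⟨x₀, hx₀, hx₀G, hx₀s⟩ : ∃ x₀ ∈ ball x (r / 100), x₀ ∈ G ∧ x₀ ∈ μ.support := by
      have hpos : 0 < μ (ball x (r / 100) ∩ G) := by
        by_contra! h0
        have h1 : μ (ball x (r / 100)) ≤ μ (ball x r \ G) := by
          calc μ (ball x (r / 100)) ≤ μ (ball x (r / 100) ∩ G) + μ (ball x (r / 100) \ G) :=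
                measure_le_inter_add_sdiff _ _ _
            _ ≤ 0 + μ (ball x r \ G) := by
                gcongr
                linarith
            _ = _ := zero_add _
        have h2 := ENNReal.toReal_mono (ENNReal.mul_ne_top ENNReal.ofReal_ne_top
          measure_ball_lt_top.ne) (h1.trans hbad)
        rw [ENNReal.toReal_mul, ENNReal.toReal_ofReal hκ0.le] at h2
        change μ.real (ball x (r / 100)) ≤ κ * μ.real (ball x r) at h2
        have h3 : μ.real (ball x r) ≤ C ^ 7 * μ.real (ball x (r / 100)) :=
          (measureReal_ball_mono (ball_subset_ball (by linarith))).trans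
            (hμ.measureReal_pow_le hC0.le hx (t := r / 100) (by positivity) 7)
        have h4 : 0 < μ.real (ball x r) := measureReal_ball_pos hx hr
        have h5 : κ ≤ 1 / (2 * C ^ 7) := min_le_right _ _
        have h6 : μ.real (ball x r) ≤ C ^ 7 * (1 / (2 * C ^ 7) * μ.real (ball x r)) := by
          refine h3.trans ?_
          gcongr
          exact h2.trans (by gcongr)
        have h7 : C ^ 7 * (1 / (2 * C ^ 7) * μ.real (ball x r)) = μ.real (ball x r) / 2 := by
          field_simp
        linarith
      obtain ⟨x₀, ⟨h1, h2⟩, h3⟩ := Measure.nonempty_inter_support_of_pos hpos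
      exact ⟨x₀, h1, h2, h3⟩
    obtain ⟨b, hbe, hb, z, ⟨hzS, hzx⟩, t, ht, hα⟩ := hgood x₀ hx₀G 0
    have hR00 : R 0 = r := by simp [hRdef]
    simp only [hI, hR2, hR00, mem_Ico] at ht
    rw [hR00] at hzx
    obtain ⟨p, J, c, hc, happ⟩ := exists_flatApprox_of_alphaNumber_lt hC hμ hzS.1 hx hr
      (by linarith [ht.1]) ht.2 (by
        have := dist_triangle z x₀ x
        have := mem_ball.1 hzx
        have := mem_ball.1 hx₀
        linarith) hb hα
    refine ⟨p, J, c, hc, happ.mono_ball subset_rfl ?_⟩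
    gcongr
    have := hsum x₀ hx₀G 1
    rw [Finset.sum_range_one, ← hbe] at this
    refine le_trans ?_ hη₁C
    gcongr
  · intro y hyG hys hyx
    have hex : ∀ k, ∃ (p : EuclideanSpace ℝ (Fin n))
        (J : EuclideanSpace ℝ (Fin d) →ₗᵢ[ℝ] EuclideanSpace ℝ (Fin n)) (c : ℝ), 0 ≤ c ∧
        FlatApprox μ y (3 / 2 * R k) p J c (2 * C ^ 3 * ((β k y).toReal + η₁ / 2 / 2 ^ k) * R k
          * μ.real (ball y (R k / 2))) := by
      intro k
      obtain ⟨b, hbe, hb, z, ⟨hzS, hzy⟩, t, ht, hα⟩ := hgood y hyG k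
      simp only [hI, hR2, mem_Ico] at ht
      rw [← hbe]
      refine exists_flatApprox_of_alphaNumber_lt hC hμ hzS.1 hys (hR0 k)
        (by linarith [ht.1]) ht.2 (by linarith [mem_ball.1 hzy, hR0 k]) hb hα
    choose p J c hc happ using hex
    refine ⟨p, J, c, fun k => 2 * C ^ 3 * ((β k y).toReal + η₁ / 2 / 2 ^ k), hc,
      fun k => by positivity, fun N => ?_, happ⟩
    rw [← Finset.mul_sum]
    refine le_trans ?_ hη₁C
    gcongr
    exact hsum y hyG N

/-! ### Differentiation of measures and Lipschitz graphs. -/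

open Filter Topology

/-- Comparison of two measures by comparing them on a sequence of small closed balls. -/
theorem measure_le_of_eventually_closedBall_le {d : ℕ} {ρ ν : Measure (EuclideanSpace ℝ (Fin d))}
    [IsLocallyFiniteMeasure ρ] [IsLocallyFiniteMeasure ν] {τ : ℕ → ℝ} (hτ : ∀ k, 0 < τ k)
    (hτ' : Tendsto τ atTop (𝓝 0)) {S : Set (EuclideanSpace ℝ (Fin d))}
    (h : ∀ q ∈ S, ∀ᶠ k in atTop, ρ (closedBall q (τ k)) ≤ ν (closedBall q (τ k))) :
    ρ S ≤ ν S := by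
  refine (Besicovitch.vitaliFamily ρ).measure_le_of_frequently_le ν Measure.AbsolutelyContinuous.rfl
    S fun q hq => ?_
  have h1 : Tendsto τ atTop (𝓝[>] 0) :=
    tendsto_nhdsWithin_iff.2 ⟨hτ', .of_forall hτ⟩
  exact ((Besicovitch.tendsto_filterAt ρ q).comp h1).frequently (h q hq).frequently

section Graph

variable {d n : ℕ} {μ : Measure (EuclideanSpace ℝ (Fin n))} [IsLocallyFiniteMeasure μ]
  {J : EuclideanSpace ℝ (Fin d) →ₗᵢ[ℝ] EuclideanSpace ℝ (Fin n)}
  {A Z : Set (EuclideanSpace ℝ (Fin n))} {Λ : ℝ≥0}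

theorem coord_injOn_of_norm_sub_le (hg : ∀ y ∈ A, ∀ z ∈ A, ‖y - z‖ ≤ Λ * ‖coord J (y - z)‖) :
    InjOn (coord J) A := by
  intro y hy z hz hyz
  have := hg y hy z hz
  rw [map_sub, hyz, sub_self, norm_zero, mul_zero] at this
  exact sub_eq_zero.1 (norm_le_zero_iff.1 this)

theorem hausdorffN_coord_image_le (Z : Set (EuclideanSpace ℝ (Fin n))) :
    hausdorffN d d (coord J '' Z) ≤ hausdorffN d n Z := by
  have : LipschitzOnWith 1 (coord J) Z := LipschitzOnWith.of_dist_le_mul fun y _ z _ => by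
    rw [dist_eq_norm, dist_eq_norm, ← map_sub, NNReal.coe_one, one_mul]
    exact norm_coord_le J _
  simpa using hausdorffN_image_le (d := d) this

theorem hausdorffN_le_coord_image (hg : ∀ y ∈ A, ∀ z ∈ A, ‖y - z‖ ≤ Λ * ‖coord J (y - z)‖)
    (hZ : Z ⊆ A) : hausdorffN d n Z ≤ (Λ : ℝ≥0∞) ^ d * hausdorffN d d (coord J '' Z) := by
  have hinj := coord_injOn_of_norm_sub_le hg
  rcases Z.eq_empty_or_nonempty with rfl | ⟨z₀, -⟩
  · simp
  have : Nonempty (EuclideanSpace ℝ (Fin n)) := ⟨z₀⟩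
  set g := Function.invFunOn (coord J) A with hgdef
  have hgl : ∀ y ∈ Z, g (coord J y) = y := fun y hy => hinj.leftInvOn_invFunOn (hZ hy)
  have himg : g '' (coord J '' Z) = Z := by
    rw [image_image]
    exact (image_congr hgl).trans (image_id' Z)
  have hL : LipschitzOnWith Λ g (coord J '' Z) := by
    refine LipschitzOnWith.of_dist_le_mul ?_
    rintro _ ⟨y, hy, rfl⟩ _ ⟨z, hz, rfl⟩
    rw [hgl y hy, hgl z hz, dist_eq_norm, dist_eq_norm, ← map_sub]
    exact hg y (hZ hy) z (hZ hz)
  conv_lhs => rw [← himg]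
  exact hausdorffN_image_le hL

omit [IsLocallyFiniteMeasure μ] in
theorem map_coord_restrict_image (hinj : InjOn (coord J) A) (hZm : MeasurableSet Z) (hZ : Z ⊆ A) :
    (μ.restrict A).map (coord J) (coord J '' Z) = μ Z := by
  have hm : MeasurableSet (coord J '' Z) :=
    hZm.image_of_continuousOn_injOn (coord J).continuous.continuousOn (hinj.mono hZ)
  rw [Measure.map_apply (coord J).continuous.measurable hm,
    Measure.restrict_apply ((coord J).continuous.measurable hm)]
  congr 1
  ext z
  constructor
  · rintro ⟨⟨w, hw, hwz⟩, hz⟩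
    rwa [← hinj (hZ hw) hz hwz]
  · exact fun hz => ⟨⟨z, hz, rfl⟩, hZ hz⟩

variable {τ : ℕ → ℝ} {a : ℝ}

/-- An upper density bound on a Lipschitz graph bounds the measure by the Hausdorff measure. -/
theorem measure_le_hausdorffN_of_density_le (hAfin : μ A ≠ ∞)
    (hg : ∀ y ∈ A, ∀ z ∈ A, ‖y - z‖ ≤ Λ * ‖coord J (y - z)‖) (hΛ : 0 < Λ)
    (hτ : ∀ k, 0 < τ k) (hτ' : Tendsto τ atTop (𝓝 0)) (ha : 0 ≤ a)
    (hd : ∀ y ∈ A, ∀ k, μ.real (closedBall y (τ k)) ≤ a * τ k ^ d)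
    (hZm : MeasurableSet Z) (hZ : Z ⊆ A) :
    μ Z ≤ ENNReal.ofReal (a * Λ ^ d) * hausdorffN d n Z := by
  have hΛ' : (0 : ℝ) < Λ := hΛ
  have : IsFiniteMeasure (μ.restrict A) := ⟨by simpa using hAfin.lt_top⟩
  have key : (μ.restrict A).map (coord J) (coord J '' Z)
      ≤ (Real.toNNReal (a * Λ ^ d) • hausdorffN d d) (coord J '' Z) := by
    -- Points of `A` over the coordinate ball of radius τ/Λ lie in the closed ball of radius τ
    -- around `y`; this rescaling produces the factor Λᵈ.
    refine measure_le_of_eventually_closedBall_le (τ := fun k => τ k / Λ)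
      (fun k => div_pos (hτ k) hΛ') (by simpa using hτ'.div_const (Λ : ℝ)) ?_
    rintro _ ⟨y, hy, rfl⟩
    refine .of_forall fun k => ?_
    rw [Measure.map_apply (coord J).continuous.measurable measurableSet_closedBall,
      Measure.restrict_apply ((coord J).continuous.measurable measurableSet_closedBall)]
    have hsub : coord J ⁻¹' closedBall (coord J y) (τ k / Λ) ∩ A ⊆ closedBall y (τ k) := by
      rintro z ⟨hz, hzA⟩
      simp only [mem_preimage, mem_closedBall, dist_eq_norm, ← map_sub] at hz ⊢
      rw [le_div_iff₀ hΛ'] at hz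
      linarith [hg z hzA y (hZ hy)]
    have h1 : μ (closedBall y (τ k)) ≤ ENNReal.ofReal (a * τ k ^ d) := by
      rw [← ENNReal.ofReal_toReal (measure_closedBall_lt_top (μ := μ) (x := y) (r := τ k)).ne]
      exact ENNReal.ofReal_le_ofReal (hd y (hZ hy) k)
    refine (measure_mono hsub).trans (h1.trans (le_of_eq ?_))
    rw [Measure.coe_nnreal_smul_apply, hausdorffN_closedBall _ (div_pos (hτ k) hΛ').le]
    change _ = ENNReal.ofReal _ * _
    rw [← ENNReal.ofReal_mul (by positivity)]
    congr 1
    rw [div_pow]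
    field_simp
  rw [map_coord_restrict_image (coord_injOn_of_norm_sub_le hg) hZm hZ,
    Measure.coe_nnreal_smul_apply] at key
  refine key.trans ?_
  change ENNReal.ofReal _ * _ ≤ _
  gcongr
  exact hausdorffN_coord_image_le Z

omit [IsLocallyFiniteMeasure μ] in
/-- A lower density bound at the density points of a Lipschitz graph bounds the measure from below
by the Hausdorff measure. -/
theorem hausdorffN_le_measure_of_le_density (hAfin : μ A ≠ ∞)
    (hg : ∀ y ∈ A, ∀ z ∈ A, ‖y - z‖ ≤ Λ * ‖coord J (y - z)‖) (hΛ : 0 < Λ)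
    (hτ : ∀ k, 0 < τ k) (hτ' : Tendsto τ atTop (𝓝 0)) (ha : 0 ≤ a)
    (hd : ∀ y ∈ A, ∀ᶠ k in atTop, a * τ k ^ d ≤ μ.real (A ∩ closedBall y (τ k)))
    (hZm : MeasurableSet Z) (hZ : Z ⊆ A) :
    ENNReal.ofReal (a / Λ ^ d) * hausdorffN d n Z ≤ μ Z := by
  have hΛ' : (0 : ℝ) < Λ := hΛ
  have : IsFiniteMeasure (μ.restrict A) := ⟨by simpa using hAfin.lt_top⟩
  have key : (Real.toNNReal a • hausdorffN d d) (coord J '' Z)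
      ≤ (μ.restrict A).map (coord J) (coord J '' Z) := by
    refine measure_le_of_eventually_closedBall_le hτ hτ' ?_
    rintro _ ⟨y, hy, rfl⟩
    filter_upwards [hd y (hZ hy)] with k hk
    rw [Measure.map_apply (coord J).continuous.measurable measurableSet_closedBall,
      Measure.restrict_apply ((coord J).continuous.measurable measurableSet_closedBall)]
    -- The projection is 1-Lipschitz, so radii are kept here; Λᵈ is lost only when lifting ℋᵈ from
    -- ℝᵈ back to `Z`.
    have hsub : A ∩ closedBall y (τ k) ⊆ coord J ⁻¹' closedBall (coord J y) (τ k) ∩ A := by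
      rintro z ⟨hzA, hz⟩
      refine ⟨?_, hzA⟩
      simp only [mem_preimage, mem_closedBall, dist_eq_norm, ← map_sub] at hz ⊢
      exact (norm_coord_le J _).trans hz
    refine le_trans ?_ (measure_mono hsub)
    rw [Measure.coe_nnreal_smul_apply, hausdorffN_closedBall _ (hτ k).le]
    change ENNReal.ofReal _ * _ ≤ _
    rw [← ENNReal.ofReal_mul ha, ← ENNReal.ofReal_toReal
      (measure_ne_top_of_subset inter_subset_left hAfin : μ (A ∩ closedBall y (τ k)) ≠ ∞)]
    exact ENNReal.ofReal_le_ofReal hk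
  rw [map_coord_restrict_image (coord_injOn_of_norm_sub_le hg) hZm hZ,
    Measure.coe_nnreal_smul_apply] at key
  change ENNReal.ofReal a * _ ≤ _ at key
  refine le_trans ?_ key
  calc ENNReal.ofReal (a / Λ ^ d) * hausdorffN d n Z
      ≤ ENNReal.ofReal (a / Λ ^ d) * ((Λ : ℝ≥0∞) ^ d * hausdorffN d d (coord J '' Z)) := by
        gcongr
        exact hausdorffN_le_coord_image hg hZ
    _ = ENNReal.ofReal a * hausdorffN d d (coord J '' Z) := by
        rw [← mul_assoc, ← ENNReal.ofReal_coe_nnreal, ← ENNReal.ofReal_pow hΛ'.le,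
          ← ENNReal.ofReal_mul (by positivity), div_mul_cancel₀ _ (by positivity)]

/-- A set on which the normal component of differences is small lies in a Lipschitz graph. -/
theorem exists_isLipschitzGraph {γ : ℝ} (hγ : 0 ≤ γ)
    (hg : ∀ y ∈ A, ∀ z ∈ A, ‖normalPart J (y - z)‖ ≤ γ * ‖coord J (y - z)‖) :
    ∃ Γ : Set (EuclideanSpace ℝ (Fin n)), IsLipschitzGraph d γ Γ ∧ A ⊆ Γ := by
  set V : Submodule ℝ (EuclideanSpace ℝ (Fin n)) := LinearMap.range J.toLinearMap with hV
  have hVd : Module.finrank ℝ V = d := by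
    rw [hV, LinearMap.finrank_range_of_inj J.injective, finrank_euclideanSpace_fin]
  let P : EuclideanSpace ℝ (Fin n) → V := fun y => ⟨J (coord J y), ⟨coord J y, rfl⟩⟩
  have hNmem : ∀ y, normalPart J y ∈ Vᗮ := by
    intro y
    rw [Submodule.mem_orthogonal]
    rintro _ ⟨v, rfl⟩
    have := ContinuousLinearMap.adjoint_inner_right J.toContinuousLinearMap v (normalPart J y)
    rw [← coord, coord_normalPart, inner_zero_right] at this
    exact this.symm
  let N : EuclideanSpace ℝ (Fin n) → Vᗮ := fun y => ⟨normalPart J y, hNmem y⟩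
  have hPN : ∀ y ∈ A, ∀ z ∈ A, ‖N y - N z‖ ≤ γ * ‖P y - P z‖ := by
    intro y hy z hz
    have h1 : ‖N y - N z‖ = ‖normalPart J (y - z)‖ := by
      rw [map_sub]; rfl
    have h2 : ‖P y - P z‖ = ‖coord J (y - z)‖ := by
      rw [← J.norm_map, map_sub, map_sub]; rfl
    rw [h1, h2]
    exact hg y hy z hz
  -- The choice of preimage is harmless: by `hPN` the normal part over `A` depends only on the
  -- projection.
  let σ : V → EuclideanSpace ℝ (Fin n) := Function.invFunOn P A
  have hσA : ∀ v ∈ P '' A, σ v ∈ A := fun v hv => Function.invFunOn_mem hv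
  have hσP : ∀ v ∈ P '' A, P (σ v) = v := fun v hv => Function.invFunOn_eq hv
  obtain ⟨f, hf, hfeq⟩ := exists_extension_norm_sub_le (s := P '' A) (g := fun v => N (σ v)) hγ
    (fun u hu v hv => by
      have := hPN _ (hσA u hu) _ (hσA v hv)
      rwa [hσP u hu, hσP v hv] at this)
  refine ⟨_, ⟨V, f, hVd, hf, rfl⟩, fun y hy => ⟨P y, ?_⟩⟩
  have hPy : P y ∈ P '' A := ⟨y, hy, rfl⟩
  have h1 : N (σ (P y)) = N y := by
    have := hPN _ (hσA _ hPy) y hy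
    rw [hσP _ hPy, sub_self, norm_zero, mul_zero] at this
    exact sub_eq_zero.1 (norm_le_zero_iff.1 this)
  have h2 : f (P y) = N y := (hfeq hPy).trans h1
  simp only [h2, P, N, normalPart_apply, add_sub_cancel]

end Graph

/-! ### Choice of parameters and conclusion. -/

/-- The distortion constants tend to one. -/
theorem exists_distortion_le (d : ℕ) {γ : ℝ} (hγ : 0 < γ) :
    ∃ s : ℝ, 0 < s ∧ s ≤ 1 / 4 ∧ s ≤ γ / 2 ∧
      (1 + s) ^ d * (1 + s) / (1 - s) * (1 / (1 - s)) ^ d * ((1 + s) / (1 - 2 * s) ^ d) ≤ 1 + γ ∧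
      1 - γ ≤ (1 - s) * ((1 - 2 * s) ^ d * (1 - s) / (1 + s)) / (1 / (1 - s)) ^ d
        * ((1 - s) / (1 + s) ^ d) := by
  -- Both expressions are continuous in s at 0, with value 1 there.
  have hU : ContinuousAt (fun s : ℝ => (1 + s) ^ d * (1 + s) / (1 - s) * (1 / (1 - s)) ^ d
      * ((1 + s) / (1 - 2 * s) ^ d)) 0 := by
    fun_prop (disch := simp)
  have hL : ContinuousAt (fun s : ℝ => (1 - s) * ((1 - 2 * s) ^ d * (1 - s) / (1 + s))
      / (1 / (1 - s)) ^ d * ((1 - s) / (1 + s) ^ d)) 0 := by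
    fun_prop (disch := simp)
  have hU' := hU.eventually_lt (continuousAt_const (y := 1 + γ)) (by simpa using hγ)
  have hL' := (continuousAt_const (y := 1 - γ)).eventually_lt hL (by simpa using hγ)
  have h4 : ∀ᶠ s in 𝓝 (0 : ℝ), s < 1 / 4 := eventually_lt_nhds (by norm_num)
  have hγ' : ∀ᶠ s in 𝓝 (0 : ℝ), s < γ / 2 := eventually_lt_nhds (by positivity)
  have hall := (hU'.and (hL'.and (h4.and hγ'))).filter_mono (nhdsWithin_le_nhds (s := Ioi 0))
  obtain ⟨s, ⟨h1, h2, h3, h5⟩, hs⟩ := (hall.and self_mem_nhdsWithin).exists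
  exact ⟨s, hs, h3.le, h5.le, h1.le, h2.le⟩

theorem theorem1p7 (d : ℕ) (hd : 1 ≤ d) (Cδ : ℝ) (hCδ : 1 ≤ Cδ) (γ : ℝ) (hγ : 0 < γ)
    (hγ' : γ < 1) :
    ∃ C₁ : ℝ, 0 < C₁ ∧
      ∀ (n : ℕ), d ≤ n →
      ∀ (μ : Measure (EuclideanSpace ℝ (Fin n))), IsLocallyFiniteMeasure μ →
        IsDoublingWith Cδ μ →
      ∀ (x : EuclideanSpace ℝ (Fin n)) (r : ℝ), x ∈ μ.support → 0 < r →
        CarlesonCondition d C₁ μ x r →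
      ∃ A : Set (EuclideanSpace ℝ (Fin n)), MeasurableSet A ∧ A ⊆ ball x r ∧
        μ (ball x r \ A) ≤ ENNReal.ofReal γ * μ (ball x r) ∧
        (∃ Γ : Set (EuclideanSpace ℝ (Fin n)), IsLipschitzGraph d γ Γ ∧ A ⊆ Γ) ∧
        ∀ Z : Set (EuclideanSpace ℝ (Fin n)), MeasurableSet Z → Z ⊆ A →
          ENNReal.ofReal (1 - γ) * (hausdorffN d n Z / ENNReal.ofReal r ^ d)
              ≤ μ Z / μ (ball x r) ∧
          μ Z / μ (ball x r)
              ≤ ENNReal.ofReal (1 + γ) * (hausdorffN d n Z / ENNReal.ofReal r ^ d) := by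
  obtain ⟨s, hs, hs4, hsγ, hU, hL⟩ := exists_distortion_le d hγ
  obtain ⟨η, hη, hgood⟩ := exists_good_point_const d hCδ hs hs4
  obtain ⟨C₁, hC₁, hcarl⟩ := exists_carleson_const d hCδ hη hγ
  refine ⟨C₁, hC₁, fun n _ μ _ hμ x r hx hr hcar => ?_⟩
  obtain ⟨⟨p, J, c, hc, happ⟩, G, hGm, hGbad, hG⟩ := hcarl n μ hμ x r hx hr hcar
  obtain ⟨⟨hx1, hx2⟩, hpt⟩ := hgood n μ hμ x p r c J hr hx hc happ
  set A₀ : Set (EuclideanSpace ℝ (Fin n)) := ball x r ∩ G ∩ μ.support with hA₀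
  have hA₀m : MeasurableSet A₀ :=
    (measurableSet_ball.inter hGm).inter Measure.isClosed_support.measurableSet
  set T : Set (EuclideanSpace ℝ (Fin n)) := {y | y ∈ A₀ → Tendsto
    (fun t => μ (A₀ ∩ closedBall y t) / μ (closedBall y t)) (𝓝[>] 0) (𝓝 1)} with hT
  have hTae : μ Tᶜ = 0 :=
    (ae_restrict_iff' hA₀m).1 (Besicovitch.ae_tendsto_measure_inter_div μ A₀)
  -- The points of `A₀` that are not density points form a null set; a measurable null superset is
  -- removed to keep `A` Borel.
  set N := toMeasurable μ Tᶜ with hN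
  have hNm : MeasurableSet N := measurableSet_toMeasurable _ _
  have hN0 : μ N = 0 := by rw [hN, measure_toMeasurable, hTae]
  set A := A₀ \ N with hA
  have hAm : MeasurableSet A := hA₀m.diff hNm
  have hAA₀ : A ⊆ A₀ := sdiff_subset
  have hAB : A ⊆ ball x r := fun y hy => (hAA₀ hy).1.1
  have hAfin : μ A ≠ ∞ := measure_ne_top_of_subset hAB measure_ball_lt_top.ne
  have hAs : ∀ y ∈ A, y ∈ μ.support := fun y hy => (hAA₀ hy).2
  have hAgood : ∀ y ∈ A, IsGoodPoint d μ r η y := fun y hy =>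
    hG y (hAA₀ hy).1.2 (hAs y hy) (hAB hy)
  have hs1 : 0 < 1 - s := by linarith
  have hs2 : 0 < 1 - 2 * s := by linarith
  have hnorm : ∀ y ∈ A, ∀ z ∈ A, ‖normalPart J (y - z)‖ ≤ s * ‖y - z‖ := fun y hy z hz =>
    (hpt y (hAs y hy) (hAB hy) (hAgood y hy)).1 z (hAs z hz) (hAB hz)
  set Λ : ℝ≥0 := Real.toNNReal (1 / (1 - s)) with hΛ
  have hΛr : (Λ : ℝ) = 1 / (1 - s) := Real.coe_toNNReal _ (by positivity)
  have hΛ0 : 0 < Λ := by rw [hΛ, Real.toNNReal_pos]; positivity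
  have hgraph : ∀ y ∈ A, ∀ z ∈ A, ‖y - z‖ ≤ Λ * ‖coord J (y - z)‖ := by
    intro y hy z hz
    have h1 := norm_le_coord_add_normalPart J (y - z)
    have h2 := hnorm y hy z hz
    rw [hΛr, div_mul_eq_mul_div, le_div_iff₀ hs1]
    linarith
  refine ⟨A, hAm, hAB, ?_, ?_, ?_⟩
  · have hsub : ball x r \ A ⊆ (ball x r \ G) ∪ (μ.supportᶜ ∪ N) := by
      intro y hy
      by_cases hyG : y ∈ G
      · by_cases hys : y ∈ μ.support
        · exact Or.inr (Or.inr (by_contra fun hyN => hy.2 ⟨⟨⟨hy.1, hyG⟩, hys⟩, hyN⟩))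
        · exact Or.inr (Or.inl hys)
      · exact Or.inl ⟨hy.1, hyG⟩
    refine (measure_mono hsub).trans ((measure_union_le _ _).trans ?_)
    rw [measure_union_null Measure.measure_compl_support hN0, add_zero]
    exact hGbad
  · refine exists_isLipschitzGraph (J := J) hγ.le fun y hy z hz => ?_
    refine (hnorm y hy z hz).trans ?_
    calc s * ‖y - z‖ ≤ s * (Λ * ‖coord J (y - z)‖) := by
          gcongr
          exact hgraph y hy z hz
      _ = s / (1 - s) * ‖coord J (y - z)‖ := by rw [hΛr]; ring
      _ ≤ γ * ‖coord J (y - z)‖ := by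
          gcongr
          rw [div_le_iff₀ hs1]
          nlinarith
  intro Z hZm hZ
  set τ : ℕ → ℝ := fun k => r / 2 ^ k with hτ
  have hτ0 : ∀ k, 0 < τ k := fun k => by positivity
  have hτlim : Tendsto τ atTop (𝓝 0) := by
    have := (tendsto_pow_atTop_nhds_zero_of_lt_one (r := (1 / 2 : ℝ)) (by norm_num)
      (by norm_num)).const_mul r
    simpa [hτ, div_eq_mul_inv] using this
  set M := μ.real (ball x r) with hM
  have hM0 : 0 < M := measureReal_ball_pos hx hr
  set lo : ℝ := (1 - 2 * s) ^ d * (1 - s) / (1 + s) with hlo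
  set hi : ℝ := (1 + s) ^ d * (1 + s) / (1 - s) with hhi
  have hlo0 : 0 ≤ lo := by positivity
  have hhi0 : 0 ≤ hi := by positivity
  -- These two bounds trade the coefficient of the fixed plane for μ(B)/rᵈ, up to factors tending to
  -- 1 as s tends to 0.
  have hcM : c * r ^ d ≤ (1 + s) / (1 - 2 * s) ^ d * M := by
    rw [div_mul_eq_mul_div, le_div_iff₀ (by positivity)]
    linarith
  have hMc : (1 - s) / (1 + s) ^ d * M ≤ c * r ^ d := by
    rw [div_mul_eq_mul_div, div_le_iff₀ (by positivity)]
    linarith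
  have hup : μ Z ≤ ENNReal.ofReal (hi * c * Λ ^ d) * hausdorffN d n Z := by
    refine measure_le_hausdorffN_of_density_le hAfin hgraph hΛ0 hτ0 hτlim (by positivity)
      (fun y hy k => ?_) hZm hZ
    have := ((hpt y (hAs y hy) (hAB hy) (hAgood y hy)).2 k).2
    rw [hhi, div_mul_eq_mul_div, div_mul_eq_mul_div, le_div_iff₀ hs1]
    linarith
  -- The lower bound on balls concerns all of `μ`; at a density point the part in `A` keeps the
  -- fraction 1 - s of it at small scales, and removing `N` changes nothing.
  have hdown : ENNReal.ofReal ((1 - s) * lo * c / Λ ^ d) * hausdorffN d n Z ≤ μ Z := by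
    refine hausdorffN_le_measure_of_le_density hAfin hgraph hΛ0 hτ0 hτlim (by positivity)
      (fun y hy => ?_) hZm hZ
    have hyT : y ∈ T := by_contra fun h => hy.2 (subset_toMeasurable _ _ h)
    have hlim : Tendsto (fun k => μ (A₀ ∩ closedBall y (τ k)) / μ (closedBall y (τ k))) atTop
        (𝓝 1) := (hyT (hAA₀ hy)).comp
      (tendsto_nhdsWithin_iff.2 ⟨hτlim, .of_forall hτ0⟩)
    have h1s : ENNReal.ofReal (1 - s) < 1 := by simpa using hs
    filter_upwards [hlim.eventually (lt_mem_nhds h1s)] with k hk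
    have hb := ((hpt y (hAs y hy) (hAB hy) (hAgood y hy)).2 k).1
    have hAeq : μ (A ∩ closedBall y (τ k)) = μ (A₀ ∩ closedBall y (τ k)) := by
      refine le_antisymm (measure_mono (inter_subset_inter_left _ hAA₀)) ?_
      have : A₀ ∩ closedBall y (τ k) ⊆ (A ∩ closedBall y (τ k)) ∪ N := fun z hz => by
        by_cases hzN : z ∈ N
        · exact Or.inr hzN
        · exact Or.inl ⟨⟨hz.1, hzN⟩, hz.2⟩
      refine (measure_mono this).trans ((measure_union_le _ _).trans ?_)
      rw [hN0, add_zero]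
    have h2 := ENNReal.mul_le_of_le_div hk.le
    rw [← hAeq] at h2
    have h3 := ENNReal.toReal_mono
      (measure_ne_top_of_subset inter_subset_left hAfin) h2
    rw [ENNReal.toReal_mul, ENNReal.toReal_ofReal hs1.le] at h3
    change (1 - s) * μ.real (closedBall y (τ k)) ≤ μ.real (A ∩ closedBall y (τ k)) at h3
    have h4 : μ.real (ball y (τ k)) ≤ μ.real (closedBall y (τ k)) :=
      measureReal_mono ball_subset_closedBall measure_closedBall_lt_top.ne
    refine le_trans ?_ h3
    rw [mul_assoc, mul_assoc]
    refine mul_le_mul_of_nonneg_left (le_trans ?_ h4) hs1.le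
    rw [hlo, div_mul_eq_mul_div, div_le_iff₀ (by positivity)]
    linarith
  have hrd : 0 < r ^ d := by positivity
  have hcoef_up : hi * c * Λ ^ d ≤ (1 + γ) * M / r ^ d := by
    rw [le_div_iff₀ hrd, hΛr]
    calc hi * c * (1 / (1 - s)) ^ d * r ^ d = hi * (1 / (1 - s)) ^ d * (c * r ^ d) := by ring
      _ ≤ hi * (1 / (1 - s)) ^ d * ((1 + s) / (1 - 2 * s) ^ d * M) := by gcongr
      _ = hi * (1 / (1 - s)) ^ d * ((1 + s) / (1 - 2 * s) ^ d) * M := by ring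
      _ ≤ (1 + γ) * M := by gcongr
  have hcoef_down : (1 - γ) * M / r ^ d ≤ (1 - s) * lo * c / Λ ^ d := by
    rw [div_le_iff₀ hrd, hΛr]
    calc (1 - γ) * M
        ≤ (1 - s) * lo / (1 / (1 - s)) ^ d * ((1 - s) / (1 + s) ^ d) * M := by gcongr
      _ = (1 - s) * lo / (1 / (1 - s)) ^ d * ((1 - s) / (1 + s) ^ d * M) := by ring
      _ ≤ (1 - s) * lo / (1 / (1 - s)) ^ d * (c * r ^ d) := by gcongr
      _ = _ := by ring
  have hB0 : μ (ball x r) ≠ 0 := (measure_ball_pos_of_mem_support hx hr).ne'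
  have hBtop : μ (ball x r) ≠ ∞ := measure_ball_lt_top.ne
  have hBM : μ (ball x r) = ENNReal.ofReal M := (ENNReal.ofReal_toReal hBtop).symm
  have hconv : ∀ a : ℝ, 0 ≤ a → ENNReal.ofReal a * (hausdorffN d n Z / ENNReal.ofReal r ^ d)
      * μ (ball x r) = ENNReal.ofReal (a * M / r ^ d) * hausdorffN d n Z := by
    intro a ha
    rw [hBM, ENNReal.ofReal_div_of_pos hrd, ENNReal.ofReal_mul ha, ENNReal.ofReal_pow hr.le]
    simp only [div_eq_mul_inv]
    ring
  constructor
  · rw [ENNReal.le_div_iff_mul_le (Or.inl hB0) (Or.inl hBtop), hconv _ (by linarith)]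
    refine le_trans ?_ hdown
    gcongr
  · rw [ENNReal.div_le_iff hB0 hBtop, hconv _ (by linarith)]
    refine hup.trans ?_
    gcongr
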